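/- Conventions. "Group" means abelian group; $p$ is a prime. For a group $G$ and $x\in G$ let $\|x\|=\inf\{2^{-i}: x\in p^iG\}$, $d(x,y)=\|x-y\|$, and for a subgroup $K$ let $d(x,K)=\inf_{y\in K}\|x-y\|$ and $\mathrm{cl}_G(K)=\{x: d(x,K)=0\}$. $G$ is $(<\lambda)$-stable if $|\mathrm{cl}_G(\langle X\rangle)|<\lambda$ for all $X\subseteq G$ with $|X|<\lambda$; it is separable if every pure subgroup of rank $1$ is a direct summand. A $\lambda$-representation of a group $H$ is a sequence $\bar H=\langle H_\alpha:\alpha<\lambda\rangle$ of subgroups of cardinality $<\lambda$ with union $H$, such that $H_\alpha\subseteq H_{\alpha+1}$ and $H_\alpha=\bigcup_{\beta<\alpha}H_\beta$ for limit $\alpha$. For $g\in H$ and $c\subseteq\lambda$, $\mathrm{Inv}_{\bar H}(g,c)$ is the set of those $\alpha\in c$ having a next element $\alpha'=\min(c\setminus(\alpha+1))$ such that $g\in (H_{\alpha'}+nH)\setminus(H_\alpha+nH)$ for some $n\ge 2$. A club guessing sequence is $\bar C=\langle C_\delta:\delta\in S\rangle$ with $S\subseteq\lambda$ and $C_\delta\subseteq\delta$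 such that for every club $E\subseteq\lambda$ the set $\{\delta\in S:C_\delta\subseteq E\}$ is stationary; $\mathrm{id}(\bar C)$ is the ideal of those $X\subseteq\lambda$ for which there is a club $E$ such that $C_\delta\not\subseteq E$ for all $\delta\in X\cap E\cap S$. Let $\Gamma_n$ be the set of strictly increasing $\rho:n\to\omega\setminus\{0\}$, and $\Gamma_\omega$ the set of $\rho\in{}^\omega\omega$ with $\rho\restriction n\in\Gamma_n$ for all $n$. For $\rho\in\Gamma_n$ put $g(\rho)=\sum_{m<n}\rho(m)$. Say that $\Gamma'\subseteq\Gamma_\omega$ satisfies $\otimes_1$ if for every $h:{}^{<\omega}\omega\to\omega$ there is $\rho^*\in\Gamma'$ with $\rho^*(n)>h(\rho^*\restriction n)$ for all but finitely many $n$. (1) Let $\Gamma'\subseteq\Gamma_\omega$ satisfy $\otimes_1$, and let $\lambda$ be a regular cardinal with $\lambda>|\Gamma'|$ (for instance, $\lambda>2^{\aleph_0}$ regular). Let $\bar C=\langle C_\delta:\delta\in S\rangle$ be a club guessing sequence on $\lambda$, and for $\delta\in S$ let $A_\delta\subseteq C_\delta$ have order type $\omega$ and consist of ordinals of uncountable cofinality.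 Assume that for every $\alpha<\lambda$ there are fewer than $\lambda$ distinct sets among the $A_\delta$ ($\delta\in S$) that are included in $\alpha$ (this is automatic if $\sup A_\delta=\delta$ for all $\delta\in S$). Let $G=G_{\Gamma'}$ be the group generated by elements $x_{\eta,\rho}$ ($n<\omega$, $\eta\in{}^n\lambda$, $\rho\in\Gamma_n$) and $y_{\eta,\rho,n}$ ($\eta$ the increasing enumeration of some $A_\delta$, $\delta\in S$; $\rho\in\Gamma'$; $n<\omega$), freely except for the relations $$p^{g(\rho)+1}x_{\eta,\rho}=0,\qquad p^{g(\rho\restriction n)+1}y_{\eta,\rho,n}=0,\qquad y_{\eta,\rho,n}-p^{\rho(n)}y_{\eta,\rho,n+1}=x_{\eta\restriction n,\rho\restriction n}.$$ Then $G$ is a reduced, separable, $(<\lambda)$-stable $p$-group of cardinality $\lambda$. Moreover, whenever $H$ is a $(<\lambda)$-stable separable $p$-group of cardinality $\lambda$, $G$ is embeddable (not necessarily purely) into $H$, and $\bar H$ is a $\lambda$-representation of $H$, then for $\mathrm{id}(\bar C)$-almost every $\delta\in S$ there is $g\in H$ with $A_\delta\subseteq\mathrm{Inv}_{\bar H}(g,C_\delta)$.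 (2) There is $\Gamma'\subseteq\Gamma_\omega$ satisfying $\otimes_1$ with $|\Gamma'|=\mathfrak d$, where $\mathfrak d$ is the least size of a family $D\subseteq{}^\omega\omega$ such that every $f\in{}^\omega\omega$ is eventually bounded by a member of $D$. Hence a family of $\mathfrak d$ branches suffices in (1). -/

import Mathlib

open scoped Cardinal Ordinal

universe u v

namespace StableGroups

/-! ### Abelian groups: purity, rank one, separability, the `p`-adic semimetric, stability -/

section Groups

variable {G : Type v} [AddCommGroup G]

/-- Every element of `G` has order a power of `p`. -/
def IsPrimaryGroup (p : ℕ) (G : Type v) [AddCommGroup G] : Prop :=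
  ∀ x : G, ∃ n : ℕ, p ^ n • x = 0

/-- The only divisible subgroup is `0`. -/
def IsReducedGroup (G : Type v) [AddCommGroup G] : Prop :=
  ∀ D : AddSubgroup G, (∀ n : ℕ, n ≠ 0 → ∀ x ∈ D, ∃ y ∈ D, n • y = x) → D = ⊥

/-- `K` is pure: an element of `K` divisible by `n` in `G` is divisible by `n` in `K`. -/
def IsPureSubgroup (K : AddSubgroup G) : Prop :=
  ∀ (n : ℕ), ∀ x ∈ K, (∃ y : G, n • y = x) → ∃ z ∈ K, n • z = x

/-- `K` has rank one: it is nonzero and no two nonzero elements of it are independent. -/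
def HasRankOne (K : AddSubgroup G) : Prop :=
  K ≠ ⊥ ∧ ∀ x ∈ K, ∀ y ∈ K, x ≠ 0 → y ≠ 0 → ∃ m n : ℤ, m • x = n • y ∧ m • x ≠ 0

/-- Every pure subgroup of rank one is a direct summand. -/
def IsSeparableGroup (G : Type v) [AddCommGroup G] : Prop :=
  ∀ K : AddSubgroup G, IsPureSubgroup K → HasRankOne K → ∃ L : AddSubgroup G, IsCompl K L

/-- The prenorm `‖x‖ = inf {2⁻ⁱ : x is divisible by pⁱ}`. -/
noncomputable def pNorm (p : ℕ) (x : G) : ℝ :=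
  sInf {r : ℝ | ∃ i : ℕ, r = (2 : ℝ)⁻¹ ^ i ∧ ∃ y : G, p ^ i • y = x}

/-- The distance `inf {‖x - a‖ : a ∈ X}` from `x` to a set `X`. -/
noncomputable def pDist (p : ℕ) (x : G) (X : Set G) : ℝ :=
  sInf {r : ℝ | ∃ a ∈ X, r = pNorm p (x - a)}

/-- The closure of a set: the points at distance `0` from it. -/
def pClosure (p : ℕ) (X : Set G) : Set G := {x | pDist p x X = 0}

/-- `G` is `(< κ)`-stable: the closure of a subgroup generated by fewer than `κ` elements has
fewer than `κ` elements. -/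
def IsStable (p : ℕ) (κ : Cardinal.{u}) (G : Type v) [AddCommGroup G] : Prop :=
  ∀ X : Set G, Cardinal.lift.{u} #X < Cardinal.lift.{v} κ →
    Cardinal.lift.{u} #(pClosure p (AddSubgroup.closure X : Set G)) < Cardinal.lift.{v} κ

end Groups

/-! ### Representations and invariants -/

/-- The set of ordinals below (the initial ordinal of) `κ`, with its order, as a type. -/
abbrev Below (κ : Cardinal.{u}) : Type u := κ.ord.ToType

section Invariants

variable {κ : Cardinal.{u}} {H : Type v} [AddCommGroup H]

/-- `⟨R α : α < κ⟩` is a `κ`-representation of `H`. -/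
structure IsRepresentation (R : Below κ → AddSubgroup H) : Prop where
  le_succ : ∀ α, R α ≤ R (Order.succ α)
  card_lt : ∀ α, Cardinal.lift.{u} #(R α) < Cardinal.lift.{v} κ
  limit : ∀ α, Order.IsSuccLimit α → (R α : Set H) = ⋃ β ∈ Set.Iio α, (R β : Set H)
  union : (⋃ α, (R α : Set H)) = Set.univ

/-- The subgroup `nH`. -/
def multiples (n : ℕ) (H : Type v) [AddCommGroup H] : AddSubgroup H :=
  (nsmulAddMonoidHom (α := H) n).range

/-- The invariant of `g` relative to `R` and `c`: those `α ∈ c` having a next element `β` in `c`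
such that, for some `n ≥ 2`, `g` is in `R β + nH` and not in `R α + nH`. -/
def Inv (R : Below κ → AddSubgroup H) (g : H) (c : Set (Below κ)) : Set (Below κ) :=
  {α | α ∈ c ∧ ∃ β, IsLeast {γ | γ ∈ c ∧ α < γ} β ∧
    ∃ n : ℕ, 2 ≤ n ∧ g ∈ R β ⊔ multiples n H ∧ g ∉ R α ⊔ multiples n H}

/-- The family of all invariants `Inv R g c`, `g ∈ H`. -/
def invFamily (R : Below κ → AddSubgroup H) (c : Set (Below κ)) : Set (Set (Below κ)) :=
  {B | ∃ g : H, B = Inv R g c}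

/-- `⟨C δ : δ ∈ S⟩` is a club guessing sequence. -/
def IsClubGuessing (S : Set (Below κ)) (C : Below κ → Set (Below κ)) : Prop :=
  (∀ δ ∈ S, C δ ⊆ Set.Iio δ) ∧ ∀ E : Set (Below κ), IsClub E → IsStationary {δ ∈ S | C δ ⊆ E}

/-- The ideal `id(C)` of those sets `X` for which some club `E` has no `δ ∈ X ∩ E` in `S` with
`C δ ⊆ E`. -/
def guessingIdeal (S : Set (Below κ)) (C : Below κ → Set (Below κ)) : Set (Set (Below κ)) :=
  {X | ∃ E : Set (Below κ), IsClub E ∧ ∀ δ ∈ X ∩ E ∩ S, ¬ C δ ⊆ E}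

end Invariants

/-! ### Branches -/

/-- Strictly increasing sequences of length `n` of positive natural numbers. -/
def GammaFin (n : ℕ) : Set (Fin n → ℕ) := {ρ | StrictMono ρ ∧ ∀ i, ρ i ≠ 0}

/-- The restriction of an infinite sequence to its first `n` terms. -/
def restr {X : Type u} (f : ℕ → X) (n : ℕ) : Fin n → X := fun i => f i

/-- Infinite sequences all of whose finite initial segments are in `GammaFin`. -/
def GammaOmega : Set (ℕ → ℕ) := {ρ | ∀ n, restr ρ n ∈ GammaFin n}

/-- For every function `h` from finite sequences of natural numbers to natural numbers there is
`ρ ∈ Γ'` with `ρ n > h (ρ ↾ n)` for all but finitely many `n`. -/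
def EventuallyDominates (Γ' : Set GammaOmega) : Prop :=
  ∀ h : (n : ℕ) → (Fin n → ℕ) → ℕ,
    ∃ ρ ∈ Γ', ∀ᶠ n in Filter.atTop, h n (restr ρ.1 n) < ρ.1 n

/-- The dominating number: the least size of a family `D` of functions `ℕ → ℕ` such that every
`f : ℕ → ℕ` is eventually bounded by some member of `D`. -/
noncomputable def dominatingNumber : Cardinal.{0} :=
  sInf {c | ∃ D : Set (ℕ → ℕ),
    (∀ f : ℕ → ℕ, ∃ g ∈ D, ∀ᶠ n in Filter.atTop, f n ≤ g n) ∧ #D = c}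

/-! ### The group built from a set of branches -/

section Construction

variable {κ : Cardinal.{u}}

/-- The increasing enumerations of the sets `A δ`, `δ ∈ S`. -/
def enumerations (S : Set (Below κ)) (A : Below κ → Set (Below κ)) : Set (ℕ → Below κ) :=
  {η | StrictMono η ∧ ∃ δ ∈ S, Set.range η = A δ}

/-- The generators `x_{η,ρ}` (`η` and `ρ` of the same finite length) and `y_{η,ρ,n}`
(`η` the enumeration of some `A δ`, `ρ` a branch in `Γ'`). -/
inductive Generator (S : Set (Below κ)) (A : Below κ → Set (Below κ)) (Γ' : Set GammaOmega) : Type u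
  | x (n : ℕ) (η : Fin n → Below κ) (ρ : GammaFin n)
  | y (η : enumerations S A) (ρ : Γ') (n : ℕ)

variable (p : ℕ) (S : Set (Below κ)) (A : Below κ → Set (Below κ)) (Γ' : Set GammaOmega)

/-- The sum `g(ρ)` of the terms of a finite sequence. -/
def total {n : ℕ} (ρ : Fin n → ℕ) : ℕ := ∑ i, ρ i

/-- `x_{η,ρ}` in the free abelian group. -/
def freeX (n : ℕ) (η : Fin n → Below κ) (ρ : GammaFin n) :
    FreeAbelianGroup (Generator S A Γ') :=
  FreeAbelianGroup.of (Generator.x n η ρ)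

/-- `y_{η,ρ,n}` in the free abelian group. -/
def freeY (η : enumerations S A) (ρ : Γ') (n : ℕ) : FreeAbelianGroup (Generator S A Γ') :=
  FreeAbelianGroup.of (Generator.y η ρ n)

/-- The defining relators: `p^(g(ρ)+1) x_{η,ρ}`, `p^(g(ρ↾n)+1) y_{η,ρ,n}` and
`y_{η,ρ,n} - p^ρ(n) y_{η,ρ,n+1} - x_{η↾n,ρ↾n}`. -/
inductive IsRelator : FreeAbelianGroup (Generator S A Γ') → Prop
  | torsionX (n : ℕ) (η : Fin n → Below κ) (ρ : GammaFin n) :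
      IsRelator (p ^ (total ρ.1 + 1) • freeX S A Γ' n η ρ)
  | torsionY (η : enumerations S A) (ρ : Γ') (n : ℕ) :
      IsRelator (p ^ (total (restr ρ.1.1 n) + 1) • freeY S A Γ' η ρ n)
  | branch (η : enumerations S A) (ρ : Γ') (n : ℕ) :
      IsRelator (freeY S A Γ' η ρ n - p ^ (ρ.1.1 n) • freeY S A Γ' η ρ (n + 1)
        - freeX S A Γ' n (restr η.1 n) ⟨restr ρ.1.1 n, ρ.1.2 n⟩)

/-- The abelian group presented by these generators and relators. -/
abbrev BranchGroup : Type u :=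
  FreeAbelianGroup (Generator S A Γ') ⧸ AddSubgroup.closure {w | IsRelator p S A Γ' w}

end Construction

end StableGroups

namespace StableGroups

/-! ### The closure of a subgroup, elements of infinite height, and separability -/

section Height

variable {G : Type v} [AddCommGroup G] {p : ℕ}

/-! Unrolling the branch relations gives formally `y_{b,n} = ∑_{m ≥ n} p^(g(ρ↾m) - g(ρ↾n)) x_{b↾m}`.
This suggests a coordinate in `ℤ/p^(g+1)` for every node, and `coord` realises it as a homomorphism.
Distinct branches eventually separate, so the nodes where the coordinates of an element are nonzero
control the generators needed to write it (`mem_closure_attachedGenerators`). Hence no nonzero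
element has infinite height, which yields reducedness and, through characters, separability. The
elements supported on nodes below `α` form a closed subgroup `groupBelow α` of size less than `κ`;
these subgroups exhaust the group, which gives stability and the cardinality.

For the invariants, stability of `H` and a closing-off argument give a club of good levels. At a
good level `α` of uncountable cofinality `R α` is closed. So if `s` is not below `α`, the image of
`p^(g(ρ)) x_s`, with `ρ` the second component of `s`, avoids `R α + p^k H` for some `k`. A branch
whose terms eventually exceed all these `k` makes the image of a multiple of some `y_{b,N+1}` detect
every level from the `(N+1)`-st on; the finitely many earlier levels are handled by adding elements
of rapidly growing height (`exists_forall_mem_Inv`).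

For the family of size `𝔡`, finite sequences are coded by numbers, and each function of a dominating
family is turned into a branch growing faster than it along the codes of its own initial segments.
-/

theorem pNorm_nonneg (x : G) : 0 ≤ pNorm p x := by
  apply Real.sInf_nonneg
  rintro r ⟨i, rfl, -⟩
  positivity

theorem pNorm_le {x : G} {i : ℕ} (h : ∃ y : G, p ^ i • y = x) : pNorm p x ≤ (2 : ℝ)⁻¹ ^ i := by
  apply csInf_le
  · refine ⟨0, ?_⟩
    rintro r ⟨i, rfl, -⟩
    positivity
  · exact ⟨i, rfl, h⟩

theorem exists_of_pNorm_lt {x : G} {i : ℕ} (h : pNorm p x < (2 : ℝ)⁻¹ ^ i) :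
    ∃ y : G, p ^ i • y = x := by
  have hne : {r : ℝ | ∃ i : ℕ, r = (2 : ℝ)⁻¹ ^ i ∧ ∃ y : G, p ^ i • y = x}.Nonempty :=
    ⟨1, 0, by simp, x, by simp⟩
  obtain ⟨r, ⟨j, rfl, y, hy⟩, hr⟩ := exists_lt_of_csInf_lt hne h
  have hij : i < j := by
    by_contra! hji
    exact absurd hr (not_lt.2 (pow_le_pow_of_le_one (by norm_num) (by norm_num) hji))
  refine ⟨p ^ (j - i) • y, ?_⟩
  rw [← mul_nsmul', ← pow_add, Nat.add_sub_cancel' hij.le, hy]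

/-- Replaces the real-valued distance by algebra: later closure arguments use only `x ∈ K + p^k G`
for all `k`. -/
theorem mem_pClosure_iff {K : AddSubgroup G} {x : G} :
    x ∈ pClosure p (K : Set G) ↔ ∀ k : ℕ, ∃ a ∈ K, ∃ y : G, p ^ k • y = x - a := by
  have hbdd : BddBelow {r : ℝ | ∃ a ∈ (K : Set G), r = pNorm p (x - a)} := by
    refine ⟨0, ?_⟩
    rintro r ⟨a, -, rfl⟩
    exact pNorm_nonneg _
  constructor
  · intro hx k
    have hlt : pDist p x (K : Set G) < (2 : ℝ)⁻¹ ^ k := by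
      rw [show pDist p x (K : Set G) = 0 from hx]
      positivity
    have hne : {r : ℝ | ∃ a ∈ (K : Set G), r = pNorm p (x - a)}.Nonempty :=
      ⟨_, 0, K.zero_mem, rfl⟩
    obtain ⟨r, ⟨a, ha, rfl⟩, hr⟩ := exists_lt_of_csInf_lt hne hlt
    exact ⟨a, ha, exists_of_pNorm_lt hr⟩
  · intro h
    refine le_antisymm (le_of_forall_pos_le_add fun ε hε => ?_) ?_
    · obtain ⟨k, hk⟩ := exists_pow_lt_of_lt_one hε (show (2 : ℝ)⁻¹ < 1 by norm_num)
      obtain ⟨a, ha, hy⟩ := h k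
      rw [zero_add]
      exact (csInf_le hbdd ⟨a, ha, rfl⟩).trans ((pNorm_le hy).trans hk.le)
    · apply Real.sInf_nonneg
      rintro r ⟨a, -, rfl⟩
      exact pNorm_nonneg _

/-- An element of `ℚ / ℤ` killed by `p ^ (k + 1)` is a multiple of any element of exact
order `p ^ (k + 1)`. -/
theorem exists_zsmul_eq_of_pow_nsmul_eq_zero (hp : p.Prime) {k : ℕ} {u w : AddCircle (1 : ℚ)}
    (hu : p ^ (k + 1) • u = 0) (hw : p ^ (k + 1) • w = 0) (hw' : p ^ k • w ≠ 0) :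
    ∃ t : ℤ, u = t • w := by
  have hp0 : ((p : ℚ) ^ (k + 1)) ≠ 0 := pow_ne_zero _ (by exact_mod_cast hp.ne_zero)
  -- The `p^(k+1)`-torsion of `ℚ/ℤ` is cyclic, generated by the class of `1/p^(k+1)`.
  have key : ∀ v : AddCircle (1 : ℚ), p ^ (k + 1) • v = 0 →
      ∃ i : ℤ, v = i • (((1 / (p : ℚ) ^ (k + 1) : ℚ)) : AddCircle (1 : ℚ)) := by
    intro v hv
    induction v using QuotientAddGroup.induction_on with
    | H q =>
      have h1 : ((p ^ (k + 1) • q : ℚ) : AddCircle (1 : ℚ)) = 0 := by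
        rw [AddCircle.coe_nsmul]; exact hv
      obtain ⟨i, hi⟩ := (AddCircle.coe_eq_zero_iff (1 : ℚ)).1 h1
      refine ⟨i, ?_⟩
      rw [← AddCircle.coe_zsmul]
      congr 1
      simp only [zsmul_eq_mul, nsmul_eq_mul, mul_one] at hi ⊢
      push_cast at hi
      rw [hi]
      field_simp
  obtain ⟨i, rfl⟩ := key u hu
  obtain ⟨j, rfl⟩ := key w hw
  set e : AddCircle (1 : ℚ) := (((1 / (p : ℚ) ^ (k + 1) : ℚ)) : AddCircle (1 : ℚ)) with he_def
  have he : p ^ (k + 1) • e = 0 := by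
    rw [he_def, ← AddCircle.coe_nsmul, nsmul_eq_mul]
    push_cast
    rw [mul_one_div_cancel hp0]
    exact AddCircle.coe_period 1
  -- If `p` divided `j`, then `p^k • w` would vanish. The Bézout inverse of `j` modulo `p^(k+1)`
  -- then gives the multiplier.
  have hj : IsCoprime j ((p : ℤ) ^ (k + 1)) := by
    apply IsCoprime.pow_right
    rw [isCoprime_comm, (Nat.prime_iff_prime_int.1 hp).irreducible.coprime_iff_not_dvd]
    rintro ⟨c, rfl⟩
    apply hw'
    have : p ^ k • ((p : ℤ) * c) • e = c • (p ^ (k + 1) • e) := by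
      simp only [← natCast_zsmul, smul_smul]
      congr 1
      push_cast
      ring
    rw [this, he, smul_zero]
  obtain ⟨a, b, hab⟩ := hj
  refine ⟨i * a, ?_⟩
  have h2 : i = i * a * j + (i * b) * (p : ℤ) ^ (k + 1) := by
    linear_combination (-i) * hab
  conv_lhs => rw [h2]
  rw [add_smul, smul_smul, mul_smul (i * b)]
  have : ((p : ℤ) ^ (k + 1)) • e = 0 := by
    rw [← he, ← natCast_zsmul]; push_cast; rfl
  rw [this, smul_zero, add_zero]

/-- A primary group without nonzero elements of infinite height is reduced. -/
theorem isReducedGroup_of_height (hp : p.Prime)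
    (hh : ∀ x : G, (∀ k : ℕ, ∃ y : G, p ^ k • y = x) → x = 0) : IsReducedGroup G := by
  intro D hD
  rw [AddSubgroup.eq_bot_iff_forall]
  intro x hx
  refine hh x fun k => ?_
  obtain ⟨y, -, hy⟩ := hD (p ^ k) (pow_ne_zero _ hp.ne_zero) x hx
  exact ⟨y, hy⟩

/-- A primary group without nonzero elements of infinite height is separable. -/
theorem isSeparableGroup_of_height (hp : p.Prime) (hG : IsPrimaryGroup p G)
    (hh : ∀ x : G, (∀ k : ℕ, ∃ y : G, p ^ k • y = x) → x = 0) : IsSeparableGroup G := by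
  intro K hK ⟨hK0, hK1⟩
  -- an element `a` of order `p` in `K`
  obtain ⟨a, haK, ha0, hpa⟩ : ∃ a ∈ K, a ≠ 0 ∧ p • a = 0 := by
    obtain ⟨⟨x, hxK⟩, hx⟩ := AddSubgroup.ne_bot_iff_exists_ne_zero.1 hK0
    have hx0 : x ≠ 0 := fun h => hx (Subtype.ext h)
    classical
    have hex : ∃ n, p ^ n • x = 0 := hG x
    have hn0 : Nat.find hex ≠ 0 := by
      intro h0
      have := Nat.find_spec hex
      rw [h0, pow_zero, one_smul] at this
      exact hx0 this
    obtain ⟨m, hm⟩ := Nat.exists_eq_succ_of_ne_zero hn0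
    refine ⟨p ^ m • x, K.nsmul_mem hxK _, Nat.find_min hex (by omega), ?_⟩
    rw [← mul_nsmul', ← pow_succ', ← Nat.succ_eq_add_one, ← hm]
    exact Nat.find_spec hex
  -- every nonzero element of `K` has `a` among its multiples
  have hmul : ∀ x ∈ K, x ≠ 0 → ∃ t : ℤ, a = t • x := by
    intro x hx hx0
    obtain ⟨m, n, hmn, hne⟩ := hK1 x hx a haK hx0 ha0
    have hcop : IsCoprime n (p : ℤ) := by
      rw [isCoprime_comm, (Nat.prime_iff_prime_int.1 hp).irreducible.coprime_iff_not_dvd]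
      rintro ⟨c, rfl⟩
      apply hne
      rw [hmn, mul_comm, mul_smul, natCast_zsmul, hpa, smul_zero]
    obtain ⟨r, s, hrs⟩ := hcop
    refine ⟨r * m, ?_⟩
    rw [mul_smul, hmn, smul_smul]
    conv_lhs => rw [← one_smul ℤ a, ← hrs, add_smul, mul_smul s, natCast_zsmul, hpa, smul_zero,
      add_zero]
  -- the height `k` of `a`
  obtain ⟨k, ⟨b', hb'⟩, hk⟩ : ∃ k : ℕ, (∃ y : G, p ^ k • y = a) ∧ ¬ ∃ y : G, p ^ (k + 1) • y = a := by
    by_contra! hcon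
    refine ha0 (hh a fun k => ?_)
    induction k with
    | zero => exact ⟨a, by simp⟩
    | succ k ih =>
      exact hcon k ih
  obtain ⟨b, hbK, hb⟩ := hK _ a haK ⟨b', hb'⟩
  -- Since `a ∉ p^(k+1) G`, some character of `G` kills `p^(k+1) G` but not `a`. Its kernel will be
  -- the complement.
  let N : AddSubgroup G := multiples (p ^ (k + 1)) G
  have haN : (QuotientAddGroup.mk a : G ⧸ N) ≠ 0 := by
    rw [Ne, QuotientAddGroup.eq_zero_iff]
    rintro ⟨y, hy⟩
    exact hk ⟨y, hy⟩
  obtain ⟨c, hc⟩ := CharacterModule.exists_character_apply_ne_zero_of_ne_zero haN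
  let χ : G →+ AddCircle (1 : ℚ) :=
    AddMonoidHom.comp (show (G ⧸ N) →+ AddCircle (1 : ℚ) from c) (QuotientAddGroup.mk' N)
  have hχa : χ a ≠ 0 := hc
  have hχ : ∀ x, p ^ (k + 1) • χ x = 0 := by
    intro x
    rw [← map_nsmul]
    have : (QuotientAddGroup.mk' N) (p ^ (k + 1) • x) = 0 :=
      (QuotientAddGroup.eq_zero_iff _).2 ⟨x, rfl⟩
    change c ((QuotientAddGroup.mk' N) (p ^ (k + 1) • x)) = 0
    rw [this]
    exact map_zero (show (G ⧸ N) →+ AddCircle (1 : ℚ) from c)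
  have hχb : p ^ k • χ b ≠ 0 := by rwa [← map_nsmul, hb]
  -- The kernel misses `K` because every nonzero element of `K` has `a` as a multiple. Together they
  -- span because `χ b` has exact order `p^(k+1)` and so generates all values of `χ`.
  refine ⟨χ.ker, ?_, ?_⟩
  · rw [AddSubgroup.disjoint_def]
    intro x hxK hx
    by_contra hx0
    obtain ⟨t, ht⟩ := hmul x hxK hx0
    apply hχa
    rw [ht, map_zsmul, AddMonoidHom.mem_ker.1 hx, smul_zero]
  · rw [codisjoint_iff, AddSubgroup.eq_top_iff']
    intro x
    obtain ⟨t, ht⟩ := exists_zsmul_eq_of_pow_nsmul_eq_zero hp (hχ x) (hχ b) hχb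
    rw [AddSubgroup.mem_sup]
    refine ⟨t • b, K.zsmul_mem hbK t, x - t • b, ?_, by abel⟩
    rw [AddMonoidHom.mem_ker, map_sub, map_zsmul, ht, sub_self]

end Height

/-! ### Coordinates and normal forms in the group built from a set of branches -/

section Coordinates

theorem total_restr (ρ : ℕ → ℕ) (n : ℕ) : total (restr ρ n) = ∑ i ∈ Finset.range n, ρ i :=
  Fin.sum_univ_eq_sum_range ρ n

theorem total_restr_succ (ρ : ℕ → ℕ) (n : ℕ) :
    total (restr ρ (n + 1)) = total (restr ρ n) + ρ n := by
  rw [total_restr, total_restr, Finset.sum_range_succ]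

theorem total_restr_mono (ρ : ℕ → ℕ) : Monotone fun n => total (restr ρ n) :=
  monotone_nat_of_le_succ fun n => by simp only [total_restr_succ]; omega

/-- The indices `(η, ρ)` of the generators `x_{η,ρ}`. -/
abbrev Node (κ : Cardinal.{u}) : Type u := Σ n : ℕ, (Fin n → Below κ) × GammaFin n

/-- The order of the generator indexed by `s` is `p ^ (s.weight + 1)`. -/
def Node.weight {κ : Cardinal.{u}} (s : Node κ) : ℕ := total s.2.2.1

/-- The node of length `n` below the branch `(η, ρ)`. -/
def branchNode {κ : Cardinal.{u}} (η : ℕ → Below κ) (ρ : GammaOmega) (n : ℕ) : Node κ :=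
  ⟨n, restr η n, ⟨restr ρ.1 n, ρ.2 n⟩⟩

variable {κ : Cardinal.{u}}

theorem weight_branchNode (η : ℕ → Below κ) (ρ : GammaOmega) (n : ℕ) :
    (branchNode η ρ n).weight = total (restr ρ.1 n) := rfl

theorem eq_of_branchNode_eq {η η' : ℕ → Below κ} {ρ ρ' : GammaOmega} {n : ℕ}
    (h : branchNode η ρ n = branchNode η' ρ' n) : ∀ k < n, η k = η' k ∧ ρ.1 k = ρ'.1 k := by
  intro k hk
  simp only [branchNode, Sigma.mk.injEq, heq_eq_eq, true_and, Prod.mk.injEq, Subtype.mk.injEq] at h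
  exact ⟨congrFun h.1 ⟨k, hk⟩, congrFun h.2 ⟨k, hk⟩⟩

theorem eventually_branchNode_ne {η η' : ℕ → Below κ} {ρ ρ' : GammaOmega}
    (h : ¬ (η = η' ∧ ρ = ρ')) :
    ∀ᶠ n in Filter.atTop, branchNode η ρ n ≠ branchNode η' ρ' n := by
  by_contra hcon
  rw [Filter.not_eventually] at hcon
  have key : ∀ k, η k = η' k ∧ ρ.1 k = ρ'.1 k := by
    intro k
    obtain ⟨n, hn, hkn⟩ := (hcon.and_eventually (Filter.eventually_gt_atTop k)).exists
    exact eq_of_branchNode_eq (not_not.1 hn) k hkn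
  exact h ⟨funext fun k => (key k).1, Subtype.ext (funext fun k => (key k).2)⟩

variable (p : ℕ) (S : Set (Below κ)) (A : Below κ → Set (Below κ)) (Γ' : Set GammaOmega)

/-- The pairs `(η, ρ)` for which the group has generators `y_{η,ρ,n}`. -/
abbrev Branch : Type u := enumerations S A × Γ'

/-- The node of length `n` below a branch. -/
def Branch.node {S : Set (Below κ)} {A : Below κ → Set (Below κ)} {Γ' : Set GammaOmega}
    (b : Branch S A Γ') (n : ℕ) : Node κ :=
  branchNode b.1.1 b.2.1 n

theorem Branch.eventually_node_ne {S : Set (Below κ)} {A : Below κ → Set (Below κ)}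
    {Γ' : Set GammaOmega} {b b' : Branch S A Γ'} (h : b ≠ b') :
    ∀ᶠ n in Filter.atTop, b.node n ≠ b'.node n := by
  apply eventually_branchNode_ne
  rintro ⟨h1, h2⟩
  exact h (Prod.ext (Subtype.ext h1) (Subtype.ext h2))

/-- The element `x_{η,ρ}` of the group. -/
def elemX (s : Node κ) : BranchGroup p S A Γ' :=
  QuotientAddGroup.mk (freeX S A Γ' s.1 s.2.1 s.2.2)

/-- The element `y_{η,ρ,n}` of the group. -/
def elemY (b : Branch S A Γ') (n : ℕ) : BranchGroup p S A Γ' :=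
  QuotientAddGroup.mk (freeY S A Γ' b.1 b.2 n)

variable {S A Γ'} in
theorem mk_eq_zero_of_isRelator {w : FreeAbelianGroup (Generator S A Γ')}
    (h : IsRelator p S A Γ' w) : (QuotientAddGroup.mk w : BranchGroup p S A Γ') = 0 :=
  (QuotientAddGroup.eq_zero_iff _).2 (AddSubgroup.subset_closure h)

theorem pow_nsmul_elemX (s : Node κ) : p ^ (s.weight + 1) • elemX p S A Γ' s = 0 :=
  mk_eq_zero_of_isRelator p (IsRelator.torsionX s.1 s.2.1 s.2.2)

theorem pow_nsmul_elemY (b : Branch S A Γ') (n : ℕ) :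
    p ^ ((b.node n).weight + 1) • elemY p S A Γ' b n = 0 :=
  mk_eq_zero_of_isRelator p (IsRelator.torsionY b.1 b.2 n)

theorem elemY_eq (b : Branch S A Γ') (n : ℕ) :
    elemY p S A Γ' b n = elemX p S A Γ' (b.node n) +
      p ^ (b.2.1.1 n) • elemY p S A Γ' b (n + 1) := by
  have h : elemY p S A Γ' b n - p ^ (b.2.1.1 n) • elemY p S A Γ' b (n + 1)
      - elemX p S A Γ' (b.node n) = 0 :=
    mk_eq_zero_of_isRelator p (IsRelator.branch b.1 b.2 n)
  rw [sub_sub, sub_eq_zero] at h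
  rw [h, add_comm]

open Classical in
/-- The `s`-coordinate of a generator. -/
noncomputable def genCoord (s : Node κ) : Generator S A Γ' → ZMod (p ^ (s.weight + 1))
  | .x n η ρ => if (⟨n, η, ρ⟩ : Node κ) = s then 1 else 0
  -- The coefficient of `x_s` in the formal expansion of `y_{η,ρ,n}`, which involves only nodes of
  -- length at least `n` on the branch.
  | .y η ρ n => if n ≤ s.1 ∧ branchNode η.1 ρ.1 s.1 = s then
      (p : ZMod (p ^ (s.weight + 1))) ^ (s.weight - total (restr ρ.1.1 n)) else 0

theorem natCast_pow_eq_zero {m k : ℕ} (h : m ≤ k) : (p : ZMod (p ^ m)) ^ k = 0 := by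
  rw [← Nat.cast_pow, ZMod.natCast_eq_zero_iff]
  exact pow_dvd_pow p h

theorem lift_genCoord_eq_zero (s : Node κ) {w : FreeAbelianGroup (Generator S A Γ')}
    (hw : IsRelator p S A Γ' w) : FreeAbelianGroup.lift (genCoord p S A Γ' s) w = 0 := by
  cases hw with
  | torsionX n η ρ =>
    rw [map_nsmul, freeX, FreeAbelianGroup.lift_apply_of, genCoord]
    split_ifs with h
    · subst h
      rw [nsmul_eq_mul, mul_one, Nat.cast_pow]
      exact natCast_pow_eq_zero p le_rfl
    · exact smul_zero _
  | torsionY η ρ n =>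
    rw [map_nsmul, freeY, FreeAbelianGroup.lift_apply_of, genCoord]
    split_ifs with h
    -- The total exponent is at least `s.weight + 1`, even if the subtraction truncates.
    · rw [nsmul_eq_mul, Nat.cast_pow, ← pow_add]
      exact natCast_pow_eq_zero p (by omega)
    · exact smul_zero _
  | branch η ρ n =>
    rw [map_sub, map_sub, map_nsmul, freeY, freeY, freeX, FreeAbelianGroup.lift_apply_of,
      FreeAbelianGroup.lift_apply_of, FreeAbelianGroup.lift_apply_of]
    simp only [genCoord]
    by_cases hs : branchNode η.1 ρ.1 n = s
    · subst hs
      rw [if_pos ⟨le_rfl, rfl⟩, if_neg (fun h => absurd h.1 (by simp [branchNode])),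
        if_pos (by rfl), weight_branchNode, Nat.sub_self, pow_zero, smul_zero, sub_zero, sub_self]
    · rw [if_neg (show ¬ ((⟨n, restr η.1 n, ⟨restr ρ.1.1 n, ρ.1.2 n⟩⟩ : Node κ) = s) from hs),
        sub_zero, sub_eq_zero]
      by_cases hb : branchNode η.1 ρ.1 s.1 = s
      · rcases lt_trichotomy n s.1 with h | h | h
        · rw [if_pos ⟨h.le, hb⟩, if_pos ⟨h, hb⟩, nsmul_eq_mul, Nat.cast_pow, ← pow_add]
          have h1 := total_restr_mono ρ.1.1 (Nat.succ_le_of_lt h)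
          have h2 : s.weight = total (restr ρ.1.1 s.1) := by
            conv_lhs => rw [← hb]
            rfl
          simp only [Nat.succ_eq_add_one, total_restr_succ] at h1 ⊢
          congr 1
          omega
        · exact absurd (h ▸ hb) hs
        · rw [if_neg (by omega), if_neg (by omega), smul_zero]
      · rw [if_neg (fun h => hb h.2), if_neg (fun h => hb h.2), smul_zero]

/-- The `s`-coordinate of an element of the group. -/
noncomputable def coord (s : Node κ) : BranchGroup p S A Γ' →+ ZMod (p ^ (s.weight + 1)) :=
  QuotientAddGroup.lift _ (FreeAbelianGroup.lift (genCoord p S A Γ' s)) <| by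
    rw [AddSubgroup.closure_le]
    exact fun w hw => lift_genCoord_eq_zero p S A Γ' s hw

theorem coord_elemX_self (s : Node κ) : coord p S A Γ' s (elemX p S A Γ' s) = 1 := by
  change FreeAbelianGroup.lift (genCoord p S A Γ' s) (FreeAbelianGroup.of _) = 1
  rw [FreeAbelianGroup.lift_apply_of, genCoord, if_pos rfl]

theorem coord_elemX_of_ne {s t : Node κ} (h : t ≠ s) :
    coord p S A Γ' s (elemX p S A Γ' t) = 0 := by
  change FreeAbelianGroup.lift (genCoord p S A Γ' s) (FreeAbelianGroup.of _) = 0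
  rw [FreeAbelianGroup.lift_apply_of, genCoord, if_neg h]

theorem coord_elemY_of_lt {s : Node κ} (b : Branch S A Γ') {n : ℕ} (h : s.1 < n) :
    coord p S A Γ' s (elemY p S A Γ' b n) = 0 := by
  change FreeAbelianGroup.lift (genCoord p S A Γ' s) (FreeAbelianGroup.of _) = 0
  rw [FreeAbelianGroup.lift_apply_of, genCoord, if_neg (by omega)]

theorem coord_elemY_of_ne {s : Node κ} (b : Branch S A Γ') {n : ℕ} (h : b.node s.1 ≠ s) :
    coord p S A Γ' s (elemY p S A Γ' b n) = 0 := by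
  change FreeAbelianGroup.lift (genCoord p S A Γ' s) (FreeAbelianGroup.of _) = 0
  rw [FreeAbelianGroup.lift_apply_of, genCoord, if_neg fun h' => h h'.2]

theorem coord_node_elemY (b : Branch S A Γ') {n m : ℕ} (h : n ≤ m) :
    coord p S A Γ' (b.node m) (elemY p S A Γ' b n) =
      (p : ZMod (p ^ ((b.node m).weight + 1))) ^ ((b.node m).weight - (b.node n).weight) := by
  change FreeAbelianGroup.lift (genCoord p S A Γ' (b.node m)) (FreeAbelianGroup.of _) = _
  rw [FreeAbelianGroup.lift_apply_of, genCoord, if_pos ⟨h, rfl⟩]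
  rfl

/-- Every element of the group is a combination of the `x_s` with `s` of length less than `n` and
the `y_{b,n}`, for all large `n`. -/
theorem exists_normalForm (z : BranchGroup p S A Γ') :
    ∃ n₀, ∀ n ≥ n₀, ∃ (a : Node κ →₀ ℤ) (c : Branch S A Γ' →₀ ℤ), (∀ s ∈ a.support, s.1 < n) ∧
      z = Finsupp.linearCombination ℤ (elemX p S A Γ') a +
        Finsupp.linearCombination ℤ (fun b => elemY p S A Γ' b n) c := by
  classical
  induction z using QuotientAddGroup.induction_on with
  | H w =>
    induction w using FreeAbelianGroup.induction_on with
    | zero => exact ⟨0, fun n _ => ⟨0, 0, by simp, by simp⟩⟩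
    | of g =>
      cases g with
      | x n η ρ =>
        refine ⟨n + 1, fun m hm => ⟨Finsupp.single ⟨n, η, ρ⟩ 1, 0, ?_, ?_⟩⟩
        · intro s hs
          rw [Finset.mem_singleton.1 (Finsupp.support_single_subset hs)]
          exact hm
        · rw [Finsupp.linearCombination_single, map_zero, add_zero, one_smul]
          rfl
      | y η ρ k =>
        refine ⟨k, fun n hn => ?_⟩
        suffices h : ∃ (a : Node κ →₀ ℤ) (t : ℤ), (∀ s ∈ a.support, s.1 < n) ∧
            elemY p S A Γ' (η, ρ) k = Finsupp.linearCombination ℤ (elemX p S A Γ') a +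
              t • elemY p S A Γ' (η, ρ) n by
          obtain ⟨a, t, ha, h⟩ := h
          refine ⟨a, Finsupp.single (η, ρ) t, ha, ?_⟩
          rw [Finsupp.linearCombination_single]
          exact h
        induction n, hn using Nat.le_induction with
        | base => exact ⟨0, 1, by simp, by simp⟩
        | succ n hn ih =>
          obtain ⟨a, t, ha, h⟩ := ih
          let b : Branch S A Γ' := (η, ρ)
          refine ⟨a + Finsupp.single (b.node n) t, t * (p : ℤ) ^ (ρ.1.1 n), ?_, ?_⟩
          · intro s hs
            rcases Finset.mem_union.1 (Finsupp.support_add hs) with h | h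
            · exact (ha s h).trans (Nat.lt_succ_self n)
            · rw [Finset.mem_singleton.1 (Finsupp.support_single_subset h)]
              exact Nat.lt_succ_self n
          · rw [h, map_add, Finsupp.linearCombination_single, elemY_eq p S A Γ' (η, ρ) n, smul_add,
              mul_smul, ← natCast_zsmul, Nat.cast_pow, add_assoc]
    | neg g ih =>
      obtain ⟨n₀, h⟩ := ih
      refine ⟨n₀, fun n hn => ?_⟩
      obtain ⟨a, c, ha, h⟩ := h n hn
      refine ⟨-a, -c, by simpa using ha, ?_⟩
      rw [map_neg, map_neg, ← neg_add, ← h]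
      rfl
    | add v w ihv ihw =>
      obtain ⟨n₁, h₁⟩ := ihv
      obtain ⟨n₂, h₂⟩ := ihw
      refine ⟨max n₁ n₂, fun n hn => ?_⟩
      obtain ⟨a, c, ha, h⟩ := h₁ n (le_of_max_le_left hn)
      obtain ⟨a', c', ha', h'⟩ := h₂ n (le_of_max_le_right hn)
      refine ⟨a + a', c + c', ?_, ?_⟩
      · intro s hs
        rcases Finset.mem_union.1 (Finsupp.support_add hs) with hs | hs
        exacts [ha s hs, ha' s hs]
      · rw [map_add, map_add, QuotientAddGroup.mk_add, h, h']
        abel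

/-- The generators attached to a set `N` of nodes. -/
def attachedGenerators (N : Set (Node κ)) : Set (BranchGroup p S A Γ') :=
  elemX p S A Γ' '' N ∪
    {z | ∃ (b : Branch S A Γ') (n : ℕ), (∀ᶠ m in Filter.atTop, b.node m ∈ N) ∧
      z = elemY p S A Γ' b n}

/-- An element whose coordinates vanish off a set of nodes is in the subgroup generated by the
generators attached to this set. -/
theorem mem_closure_attachedGenerators (hp : p.Prime) (N : Set (Node κ)) (z : BranchGroup p S A Γ')
    (hz : ∀ s ∉ N, coord p S A Γ' s z = 0) :
    z ∈ AddSubgroup.closure (attachedGenerators p S A Γ' N) := by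
  classical
  obtain ⟨n, hn⟩ := exists_normalForm p S A Γ' z
  obtain ⟨a, c, ha, h⟩ := hn n le_rfl
  have hcoord : ∀ s, coord p S A Γ' s z = ∑ t ∈ a.support, a t • coord p S A Γ' s (elemX p S A Γ' t)
      + ∑ b ∈ c.support, c b • coord p S A Γ' s (elemY p S A Γ' b n) := by
    intro s
    rw [h, map_add, Finsupp.linearCombination_apply, Finsupp.linearCombination_apply, Finsupp.sum,
      Finsupp.sum, map_sum, map_sum]
    simp only [map_zsmul]
  rw [h, Finsupp.linearCombination_apply, Finsupp.linearCombination_apply]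
  refine add_mem (AddSubgroup.sum_mem _ fun s hs => ?_) (AddSubgroup.sum_mem _ fun b hb => ?_) <;>
    beta_reduce
  -- Since `s` is shorter than `n`, no `y_{b,n}` contributes at `s`: the coordinate there is `a s`
  -- modulo the order of `x_s`.
  · by_cases hsN : s ∈ N
    · have hs' : elemX p S A Γ' s ∈ attachedGenerators p S A Γ' N := Or.inl ⟨s, hsN, rfl⟩
      exact zsmul_mem (AddSubgroup.subset_closure hs') _
    · have h0 := hz s hsN
      rw [hcoord, Finset.sum_eq_single s (fun t _ ht => by
        rw [coord_elemX_of_ne p S A Γ' ht, smul_zero]) (fun h => absurd hs h),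
        Finset.sum_eq_zero (fun b _ => by
          rw [coord_elemY_of_lt p S A Γ' b (ha s hs), smul_zero]), add_zero, coord_elemX_self,
        zsmul_eq_mul, mul_one, ZMod.intCast_zmod_eq_zero_iff_dvd] at h0
      obtain ⟨t, ht⟩ := h0
      rw [ht, mul_comm, mul_smul, natCast_zsmul, pow_nsmul_elemX, smul_zero]
      exact zero_mem _
  · by_cases hbN : ∀ᶠ m in Filter.atTop, b.node m ∈ N
    · have hb' : elemY p S A Γ' b n ∈ attachedGenerators p S A Γ' N := Or.inr ⟨b, n, hbN, rfl⟩
      exact zsmul_mem (AddSubgroup.subset_closure hb') _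
    -- Choose a node of `b` outside `N`, so long that the other branches involved have left `b`.
    -- Only the term of `b` contributes there, with a power of `p` that cancels to leave `c b`
    -- divisible by `p^((b.node n).weight + 1)`, which kills `y_{b,n}`.
    · have hsep : ∀ᶠ m in Filter.atTop, ∀ b' ∈ c.support, b' ≠ b → b'.node m ≠ b.node m := by
        rw [Filter.eventually_all_finset]
        intro b' _
        by_cases hb' : b' = b
        · simp [hb']
        · filter_upwards [Branch.eventually_node_ne hb'] with m hm _ using hm
      obtain ⟨m, hmN, hmsep, hnm⟩ := ((Filter.not_eventually.1 hbN).and_eventually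
        (hsep.and (Filter.eventually_ge_atTop n))).exists
      have h0 := hz _ hmN
      have hle : (b.node n).weight ≤ (b.node m).weight := total_restr_mono b.2.1.1 hnm
      rw [hcoord, Finset.sum_eq_zero (fun t ht => by
          rw [coord_elemX_of_ne p S A Γ' (fun h => absurd (ha t ht) (by rw [h]; exact not_lt.2 hnm)),
            smul_zero]), zero_add,
        Finset.sum_eq_single b (fun b' hb' hne => by
          rw [coord_elemY_of_ne p S A Γ' b' (hmsep b' hb' hne), smul_zero])
          (fun h => absurd hb h), coord_node_elemY p S A Γ' b hnm, zsmul_eq_mul, ← Nat.cast_pow,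
        ← Int.cast_natCast, ← Int.cast_mul, ZMod.intCast_zmod_eq_zero_iff_dvd] at h0
      have hdvd : (p : ℤ) ^ ((b.node n).weight + 1) ∣ c b := by
        have hpos : (p : ℤ) ^ ((b.node m).weight - (b.node n).weight) ≠ 0 :=
          pow_ne_zero _ (by exact_mod_cast hp.ne_zero)
        refine Int.dvd_of_mul_dvd_mul_right hpos ?_
        rw [← pow_add]
        convert h0 using 1
        · push_cast
          congr 1
          omega
        · push_cast
          rfl
      obtain ⟨t, ht⟩ := hdvd
      rw [ht, mul_comm, mul_smul, ← Nat.cast_pow, natCast_zsmul, pow_nsmul_elemY, smul_zero]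
      exact zero_mem _

/-- An element all of whose coordinates vanish is zero. -/
theorem eq_zero_of_coord_eq_zero (hp : p.Prime) (z : BranchGroup p S A Γ')
    (hz : ∀ s, coord p S A Γ' s z = 0) : z = 0 := by
  have h := mem_closure_attachedGenerators p S A Γ' hp ∅ z fun s _ => hz s
  have h0 : attachedGenerators p S A Γ' ∅ = ∅ := by
    rw [attachedGenerators, Set.image_empty, Set.empty_union, Set.eq_empty_iff_forall_notMem]
    rintro z ⟨b, n, hb, -⟩
    exact hb.exists.choose_spec
  rwa [h0, AddSubgroup.closure_empty, AddSubgroup.mem_bot] at h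

/-- Each coordinate takes values in a group of bounded exponent. This is why vanishing of
coordinates passes to closures. -/
theorem coord_eq_zero_of_dvd {s : Node κ} {y z : BranchGroup p S A Γ'}
    (h : p ^ (s.weight + 1) • y = z) : coord p S A Γ' s z = 0 := by
  rw [← h, map_nsmul, nsmul_eq_mul, ZMod.natCast_self, zero_mul]

/-- The group has no nonzero element of infinite height. -/
theorem eq_zero_of_infinite_height (hp : p.Prime) (z : BranchGroup p S A Γ')
    (hz : ∀ k : ℕ, ∃ y : BranchGroup p S A Γ', p ^ k • y = z) : z = 0 :=
  eq_zero_of_coord_eq_zero p S A Γ' hp z fun s =>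
    coord_eq_zero_of_dvd p S A Γ' (hz (s.weight + 1)).choose_spec

theorem isPrimaryGroup_branchGroup : IsPrimaryGroup p (BranchGroup p S A Γ') := by
  intro z
  induction z using QuotientAddGroup.induction_on with
  | H w =>
    induction w using FreeAbelianGroup.induction_on with
    | zero => exact ⟨0, smul_zero _⟩
    | of g =>
      cases g with
      | x n η ρ => exact ⟨_, pow_nsmul_elemX p S A Γ' ⟨n, η, ρ⟩⟩
      | y η ρ n => exact ⟨_, pow_nsmul_elemY p S A Γ' (η, ρ) n⟩
    | neg g ih =>
      obtain ⟨n, hn⟩ := ih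
      refine ⟨n, ?_⟩
      rw [QuotientAddGroup.mk_neg, smul_neg, hn, neg_zero]
    | add v w ihv ihw =>
      obtain ⟨m, hm⟩ := ihv
      obtain ⟨n, hn⟩ := ihw
      refine ⟨m + n, ?_⟩
      rw [QuotientAddGroup.mk_add, pow_add, smul_add, mul_nsmul, hm, smul_zero, zero_add, mul_nsmul',
        hn, smul_zero]

end Coordinates

/-! ### Cardinalities -/

section Cardinality

theorem mk_addSubgroup_closure_le {G : Type u} [AddCommGroup G] (X : Set G) :
    #(AddSubgroup.closure X) ≤ max #X ℵ₀ := by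
  rcases X.eq_empty_or_nonempty with rfl | hX
  · rw [AddSubgroup.closure_empty]
    have h1 : #((⊥ : AddSubgroup G)) = 1 := Cardinal.mk_eq_one _
    rw [h1]
    exact Cardinal.one_le_aleph0.trans (le_max_right _ _)
  · have : Nonempty X := hX.to_subtype
    rw [← Cardinal.mk_freeAbelianGroup]
    have hle : AddSubgroup.closure X ≤
        (FreeAbelianGroup.lift (fun x : X => (x : G))).range := by
      rw [AddSubgroup.closure_le]
      exact fun x hx => ⟨FreeAbelianGroup.of ⟨x, hx⟩, FreeAbelianGroup.lift_apply_of _ _⟩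
    exact (Cardinal.mk_le_mk_of_subset hle).trans Cardinal.mk_range_le

variable {κ : Cardinal.{u}}

/-- Fewer than `κ` elements of a regular cardinal `κ` have a strict upper bound. -/
theorem exists_forall_lt_of_mk_lt (hκ : κ.IsRegular) {X : Set (Below κ)} (h : #X < κ) :
    ∃ α, ∀ β ∈ X, β < α := by
  rw [← not_isCofinal_iff]
  intro hX
  have := Order.cof_le hX
  rw [Ordinal.cof_toType, hκ.cof_ord] at this
  exact absurd h (not_lt.2 this)

theorem exists_forall_lt_of_range {ι : Type v} (hκ : κ.IsRegular) (f : ι → Below κ)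
    (h : Cardinal.lift.{u} #ι < Cardinal.lift.{v} κ) : ∃ α, ∀ i, f i < α := by
  obtain ⟨α, hα⟩ := exists_forall_lt_of_mk_lt hκ (X := Set.range f) (by
    rw [← Cardinal.lift_lt.{u, v}]
    exact Cardinal.mk_range_le_lift.trans_lt h)
  exact ⟨α, fun i => hα _ ⟨i, rfl⟩⟩

/-- A dominating set of branches is uncountable. -/
theorem aleph0_lt_of_eventuallyDominates {Γ' : Set GammaOmega} (h : EventuallyDominates Γ') :
    ℵ₀ < #Γ' := by
  by_contra! hle
  have hc : Γ'.Countable := Cardinal.le_aleph0_iff_set_countable.1 hle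
  obtain ⟨ρ₀, hρ₀, -⟩ := h fun _ _ => 0
  obtain ⟨f, hf⟩ := hc.exists_eq_range ⟨ρ₀, hρ₀⟩
  -- Diagonalisation: at `n` this bound is at least the `n`-th term of each of the first `n + 1`
  -- branches.
  obtain ⟨ρ, hρ, hlt⟩ := h fun n _ => ∑ k ∈ Finset.range (n + 1), (f k).1 n
  rw [hf] at hρ
  obtain ⟨k, rfl⟩ := hρ
  obtain ⟨n, hn, hkn⟩ := (hlt.and (Filter.eventually_ge_atTop k)).exists
  have := Finset.single_le_sum (f := fun k => (f k).1 n) (fun _ _ => Nat.zero_le _)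
    (Finset.mem_range.2 (Nat.lt_succ_of_le hkn))
  exact absurd hn (not_lt.2 this)

/-- The nodes `(η, ρ)` with all terms of `η` below `α`. -/
def nodesBelow (α : Below κ) : Set (Node κ) := {s | ∀ i, s.2.1 i < α}

theorem nodesBelow_mono {α β : Below κ} (h : α ≤ β) : nodesBelow α ⊆ nodesBelow β :=
  fun _ hs i => (hs i).trans_le h

theorem mk_nodesBelow_lt (hκ : ℵ₀ < κ) (α : Below κ) : #(nodesBelow α) < κ := by
  let F : nodesBelow α → List (Set.Iio α) × List ℕ := fun s =>
    (List.ofFn fun i => (⟨s.1.2.1 i, s.2 i⟩ : Set.Iio α), List.ofFn s.1.2.2.1)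
  have hF : Function.Injective F := by
    rintro ⟨⟨n, η, ρ, hρ⟩, hs⟩ ⟨⟨m, η', ρ', hρ'⟩, hs'⟩ h
    simp only [F, Prod.mk.injEq] at h
    obtain ⟨h1, h2⟩ := h
    have hnm : n = m := by simpa using congrArg List.length h1
    subst hnm
    have h1' := List.ofFn_injective h1
    have h2' := List.ofFn_injective h2
    subst h2'
    have : η = η' := funext fun i => congrArg Subtype.val (congrFun h1' i)
    subst this
    rfl
  have h1 : #(List (Set.Iio α)) < κ :=
    (Cardinal.mk_list_le_max _).trans_lt (max_lt hκ 
      ((Cardinal.mk_Iio_lt α (by simp)).trans_eq (Cardinal.mk_ord_toType κ)))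
  refine (Cardinal.mk_le_of_injective hF).trans_lt ?_
  rw [Cardinal.mk_prod]
  refine Cardinal.mul_lt_of_lt hκ.le ?_ ?_
  · simpa using h1
  · simpa using hκ

/-! ### The filtration of the group by supports, and stability. -/

variable (p : ℕ) (S : Set (Below κ)) (A : Below κ → Set (Below κ)) (Γ' : Set GammaOmega)

/-- The subgroup of elements whose coordinates vanish off the nodes below `α`. -/
noncomputable def groupBelow (α : Below κ) : AddSubgroup (BranchGroup p S A Γ') :=
  ⨅ s : {s : Node κ // s ∉ nodesBelow α}, (coord p S A Γ' s.1).ker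

variable {S A Γ'}

theorem mem_groupBelow {α : Below κ} {z : BranchGroup p S A Γ'} :
    z ∈ groupBelow p S A Γ' α ↔ ∀ s ∉ nodesBelow α, coord p S A Γ' s z = 0 := by
  simp only [groupBelow, AddSubgroup.mem_iInf, AddMonoidHom.mem_ker, Subtype.forall]

theorem groupBelow_mono {α β : Below κ} (h : α ≤ β) :
    groupBelow p S A Γ' α ≤ groupBelow p S A Γ' β := by
  intro z hz
  rw [mem_groupBelow] at hz ⊢
  exact fun s hs => hz s fun hs' => hs (nodesBelow_mono h hs')

theorem elemX_mem_groupBelow {α : Below κ} {s : Node κ} (hs : s ∈ nodesBelow α) :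
    elemX p S A Γ' s ∈ groupBelow p S A Γ' α := by
  rw [mem_groupBelow]
  intro t ht
  exact coord_elemX_of_ne p S A Γ' (by rintro rfl; exact ht hs)

theorem elemY_mem_groupBelow {α : Below κ} (b : Branch S A Γ') (hb : ∀ i, b.1.1 i < α) (n : ℕ) :
    elemY p S A Γ' b n ∈ groupBelow p S A Γ' α := by
  rw [mem_groupBelow]
  intro t ht
  refine coord_elemY_of_ne p S A Γ' b ?_
  intro h
  apply ht
  rw [← h]
  exact fun i => hb i

/-- The coordinate at `s` is `p^weight`, nonzero modulo `p^(weight+1)`. These multiples serve as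
markers of the levels of `H`. -/
theorem pow_weight_nsmul_elemX_notMem (hp : p.Prime) {α : Below κ} {s : Node κ}
    (hs : s ∉ nodesBelow α) :
    p ^ s.weight • elemX p S A Γ' s ∉ groupBelow p S A Γ' α := by
  intro h
  have h0 := (mem_groupBelow p).1 h s hs
  rw [map_nsmul, coord_elemX_self, nsmul_eq_mul, mul_one, ZMod.natCast_eq_zero_iff] at h0
  exact absurd ((Nat.pow_dvd_pow_iff_le_right hp.one_lt).1 h0) (by omega)

/-- The subgroup `groupBelow α` is closed. -/
theorem pClosure_groupBelow_subset (α : Below κ) :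
    pClosure p (groupBelow p S A Γ' α : Set (BranchGroup p S A Γ')) ⊆ groupBelow p S A Γ' α := by
  intro z hz
  rw [mem_pClosure_iff] at hz
  rw [SetLike.mem_coe, mem_groupBelow]
  intro s hs
  obtain ⟨a, ha, y, hy⟩ := hz (s.weight + 1)
  have h := coord_eq_zero_of_dvd p S A Γ' hy
  rw [map_sub, (mem_groupBelow p).1 ha s hs, sub_zero] at h
  exact h

theorem exists_mem_groupBelow (hκ : κ.IsRegular) (hκ' : ℵ₀ < κ)
    (hA : ∀ δ ∈ S, A δ ⊆ Set.Iio δ) (z : BranchGroup p S A Γ') :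
    ∃ α, z ∈ groupBelow p S A Γ' α := by
  have hne : Nonempty (Below κ) := by
    rw [Ordinal.nonempty_toType_iff, Ne, Cardinal.ord_eq_zero]
    exact hκ.ne_zero
  induction z using QuotientAddGroup.induction_on with
  | H w =>
    induction w using FreeAbelianGroup.induction_on with
    | zero => exact ⟨hne.some, zero_mem _⟩
    | of g =>
      cases g with
      | x n η ρ =>
        obtain ⟨α, hα⟩ := exists_forall_lt_of_range hκ η (by
          simpa using (Cardinal.natCast_lt_aleph0 (n := n)).trans hκ')
        exact ⟨α, elemX_mem_groupBelow p (s := ⟨n, η, ρ⟩) hα⟩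
      | y η ρ n =>
        obtain ⟨δ, hδ, hr⟩ := η.2.2
        exact ⟨δ, elemY_mem_groupBelow p (η, ρ)
          (fun i => hA δ hδ (hr ▸ Set.mem_range_self i)) n⟩
    | neg g ih =>
      obtain ⟨α, hα⟩ := ih
      exact ⟨α, neg_mem hα⟩
    | add v w ihv ihw =>
      obtain ⟨α, hα⟩ := ihv
      obtain ⟨β, hβ⟩ := ihw
      exact ⟨max α β, add_mem (groupBelow_mono p (le_max_left _ _) hα)
        (groupBelow_mono p (le_max_right _ _) hβ)⟩

/-- A branch whose nodes are eventually below `α` enumerates some `A δ ⊆ α`, so it is determined by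
one of fewer than `κ` sets and a member of `Γ'`. -/
theorem mk_groupBelow_lt (hp : p.Prime) (hκ' : ℵ₀ < κ) (hΓ : Cardinal.lift.{u} #Γ' < κ)
    {α : Below κ}
    (hα : #{a : Set (Below κ) // (∃ δ ∈ S, A δ = a) ∧ a ⊆ Set.Iio α} < κ) :
    #(groupBelow p S A Γ' α) < κ := by
  have hsub : groupBelow p S A Γ' α ≤
      AddSubgroup.closure (attachedGenerators p S A Γ' (nodesBelow α)) := fun z hz =>
    mem_closure_attachedGenerators p S A Γ' hp _ z ((mem_groupBelow p).1 hz)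
  refine (Cardinal.mk_le_mk_of_subset hsub).trans_lt
    ((mk_addSubgroup_closure_le _).trans_lt (max_lt ?_ hκ'))
  refine (Cardinal.mk_union_le _ _).trans_lt (Cardinal.add_lt_of_lt hκ'.le
    (Cardinal.mk_image_le.trans_lt (mk_nodesBelow_lt hκ' α)) ?_)
  let B : Set (Branch S A Γ') := {b | ∀ᶠ m in Filter.atTop, b.node m ∈ nodesBelow α}
  have hB : ∀ b ∈ B, Set.range b.1.1 ⊆ Set.Iio α := by
    rintro b hb _ ⟨i, rfl⟩
    obtain ⟨m, hm, him⟩ := (Filter.Eventually.and hb (Filter.eventually_gt_atTop i)).exists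
    exact hm ⟨i, him⟩
  let F : B → {a : Set (Below κ) // (∃ δ ∈ S, A δ = a) ∧ a ⊆ Set.Iio α} × Γ' := fun b =>
    (⟨Set.range b.1.1.1, ⟨b.1.1.2.2.choose, b.1.1.2.2.choose_spec.1,
      b.1.1.2.2.choose_spec.2.symm⟩, hB b.1 b.2⟩, b.1.2)
  have hF : Function.Injective F := by
    rintro ⟨⟨⟨η, hη, hη'⟩, ρ⟩, hb⟩ ⟨⟨⟨η', hη₁, hη₁'⟩, ρ'⟩, hb'⟩ h
    simp only [F, Prod.mk.injEq, Subtype.mk.injEq] at h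
    obtain ⟨h1, rfl⟩ := h
    have := (StrictMono.range_inj hη hη₁).1 h1
    subst this
    rfl
  have hBκ : #B < κ := by
    refine (Cardinal.mk_le_of_injective hF).trans_lt ?_
    rw [Cardinal.mk_prod]
    refine Cardinal.mul_lt_of_lt hκ'.le ?_ hΓ
    simpa using hα
  have hprod : #(B × ℕ) < κ := by
    rw [Cardinal.mk_prod]
    refine Cardinal.mul_lt_of_lt hκ'.le ?_ ?_
    · simpa using hBκ
    · simpa using hκ'
  refine lt_of_le_of_lt ?_ hprod
  have : {z | ∃ (b : Branch S A Γ') (n : ℕ), (∀ᶠ m in Filter.atTop, b.node m ∈ nodesBelow α) ∧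
      z = elemY p S A Γ' b n} ⊆ Set.range fun x : B × ℕ => elemY p S A Γ' x.1.1 x.2 := by
    rintro z ⟨b, n, hb, rfl⟩
    exact ⟨(⟨b, hb⟩, n), rfl⟩
  exact (Cardinal.mk_le_mk_of_subset this).trans Cardinal.mk_range_le

/-- By regularity a small set lies in a single `groupBelow α`, which is closed and small. -/
theorem isStable_branchGroup (hp : p.Prime) (hκ : κ.IsRegular) (hκ' : ℵ₀ < κ)
    (hΓ : Cardinal.lift.{u} #Γ' < κ) (hA : ∀ δ ∈ S, A δ ⊆ Set.Iio δ)
    (hfew : ∀ α : Below κ, #{a : Set (Below κ) // (∃ δ ∈ S, A δ = a) ∧ a ⊆ Set.Iio α} < κ) :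
    IsStable p κ (BranchGroup p S A Γ') := by
  intro X hX
  choose F hF using exists_mem_groupBelow (Γ' := Γ') p hκ hκ' hA
  obtain ⟨α, hα⟩ := exists_forall_lt_of_range hκ (fun x : X => F x.1) hX
  have hle : AddSubgroup.closure X ≤ groupBelow p S A Γ' α := by
    rw [AddSubgroup.closure_le]
    exact fun x hx => groupBelow_mono p (hα ⟨x, hx⟩).le (hF x)
  have hsub : pClosure p (AddSubgroup.closure X : Set (BranchGroup p S A Γ')) ⊆
      groupBelow p S A Γ' α := by
    refine fun z hz => pClosure_groupBelow_subset p α ?_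
    rw [mem_pClosure_iff] at hz ⊢
    exact fun k => (hz k).imp fun a ha => ⟨hle ha.1, ha.2⟩
  rw [Cardinal.lift_lt]
  exact (Cardinal.mk_le_mk_of_subset hsub).trans_lt (mk_groupBelow_lt p hp hκ' hΓ (hfew α))

theorem mk_branchGroup (hp : p.Prime) (hκ : κ.IsRegular) (hκ' : ℵ₀ < κ)
    (hΓ : Cardinal.lift.{u} #Γ' < κ) (hA : ∀ δ ∈ S, A δ ⊆ Set.Iio δ)
    (hfew : ∀ α : Below κ, #{a : Set (Below κ) // (∃ δ ∈ S, A δ = a) ∧ a ⊆ Set.Iio α} < κ) :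
    #(BranchGroup p S A Γ') = κ := by
  apply le_antisymm
  · have huniv : (⋃ α, (groupBelow p S A Γ' α : Set (BranchGroup p S A Γ'))) = Set.univ := by
      rw [Set.eq_univ_iff_forall]
      exact fun z => Set.mem_iUnion.2 (exists_mem_groupBelow p hκ hκ' hA z)
    rw [← Cardinal.mk_univ, ← huniv]
    refine (Cardinal.mk_iUnion_le _).trans ?_
    rw [Cardinal.mk_ord_toType]
    refine (mul_le_mul' le_rfl (ciSup_le' fun α => (mk_groupBelow_lt p hp hκ' hΓ (hfew α)).le)).trans
      (Cardinal.mul_eq_self hκ'.le).le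
  -- Nodes of length one already give `κ` distinct elements.
  · let s : Below κ → Node κ := fun α =>
      ⟨1, fun _ => α, fun _ => 1, fun i j h => absurd h (by omega), fun _ => one_ne_zero⟩
    have hinj : Function.Injective fun α => elemX p S A Γ' (s α) := by
      intro α β h
      by_contra hne
      have hs : s α ≠ s β := by
        intro h'
        simp only [s, Sigma.mk.injEq, heq_eq_eq, true_and, Prod.mk.injEq, and_true] at h'
        exact hne (congrFun h' 0)
      have h1 := coord_elemX_self p S A Γ' (s β)
      beta_reduce at h
      rw [← h, coord_elemX_of_ne p S A Γ' hs] at h1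
      have : Fact (1 < p ^ ((s β).weight + 1)) :=
        ⟨Nat.one_lt_pow (Nat.succ_ne_zero _) hp.one_lt⟩
      exact zero_ne_one h1
    have := Cardinal.mk_le_of_injective hinj
    rwa [Cardinal.mk_ord_toType] at this

end Cardinality

/-! ### The invariants of a group in which the group built from a set of branches embeds -/

section Club

variable {κ : Cardinal.{u}}

/-- The nonzero ordinals closed under a function form a club. -/
theorem isClub_closedUnder (hκ : κ.IsRegular) (hκ' : ℵ₀ < κ) (F : Below κ → Below κ) :
    IsClub {α : Below κ | (∃ β, β < α) ∧ ∀ β < α, F β < α} := by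
  refine ⟨?_, ?_⟩
  · intro s hs hne _ a ha
    obtain ⟨e, he⟩ := hne
    refine ⟨(hs he).1.imp fun β hβ => hβ.trans_le (ha.1 he), fun β hβ => ?_⟩
    obtain ⟨e, he, hβe⟩ := (lt_isLUB_iff ha).1 hβ
    exact ((hs he).2 β hβe).trans_le (ha.1 he)
  · intro a
    have hstep : ∀ γ : Below κ, ∃ γ', γ < γ' ∧ ∀ β ≤ γ, F β < γ' := by
      intro γ
      have hcard : #(F '' Set.Iio γ ∪ {F γ, γ} : Set (Below κ)) < κ := by
        refine (Cardinal.mk_union_le _ _).trans_lt (Cardinal.add_lt_of_lt hκ'.le ?_ ?_)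
        · exact Cardinal.mk_image_le.trans_lt
            ((Cardinal.mk_Iio_lt γ (by simp)).trans_eq (Cardinal.mk_ord_toType κ))
        · exact ((Set.toFinite _).lt_aleph0).trans hκ'
      obtain ⟨γ', h⟩ := exists_forall_lt_of_mk_lt hκ hcard
      refine ⟨γ', h γ (by simp), fun β hβ => ?_⟩
      rcases hβ.lt_or_eq with hβ | rfl
      · exact h _ (Or.inl ⟨β, hβ, rfl⟩)
      · exact h _ (by simp)
    choose N hN hNF using hstep
    let g : ℕ → Below κ := fun n => N^[n] a
    have hg : ∀ n, g (n + 1) = N (g n) := fun n => Function.iterate_succ_apply' N n a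
    have hbdd : {γ : Below κ | ∀ n, g n < γ}.Nonempty :=
      exists_forall_lt_of_range hκ g (by simpa using hκ')
    -- The supremum of the iterates, taken as their least strict upper bound.
    obtain ⟨γ, hγ, hmin⟩ := wellFounded_lt.has_min _ hbdd
    refine ⟨γ, ⟨⟨g 0, hγ 0⟩, fun β hβ => ?_⟩, (hγ 0).le⟩
    have : ¬ ∀ n, g n < β := fun h => hmin β h hβ
    push Not at this
    obtain ⟨n, hn⟩ := this
    exact (hNF (g n) β hn).trans (hg n ▸ hγ (n + 1))

variable {H : Type v} [AddCommGroup H]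

theorem IsRepresentation.monotone {R : Below κ → AddSubgroup H} (hR : IsRepresentation R)
    (hκ : κ.IsRegular) : Monotone R := by
  have : NoMaxOrder (Below κ) := Cardinal.noMaxOrder hκ.aleph0_le
  suffices h : ∀ β, ∀ α ≤ β, R α ≤ R β from fun α β hαβ => h β α hαβ
  intro β
  induction β using WellFoundedLT.induction with
  | ind β ih =>
    intro α hα
    rcases hα.eq_or_lt with rfl | hα
    · exact le_rfl
    by_cases hβ : Order.IsSuccPrelimit β
    · have hlim : Order.IsSuccLimit β := ⟨fun h => h.not_lt hα, hβ⟩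
      intro x hx
      have : x ∈ (R β : Set H) := by
        rw [hR.limit β hlim]
        exact Set.mem_biUnion (Set.mem_Iio.2 hα) hx
      exact this
    · obtain ⟨γ, hγ⟩ := not_forall_not.1 hβ
      obtain rfl := hγ.succ_eq
      exact (ih γ (Order.lt_succ γ) α (Order.lt_succ_iff.1 hα)).trans (hR.le_succ γ)

end Club

/-! ### Good levels and the invariants they force. -/

section Invariants

variable {κ : Cardinal.{u}} {p : ℕ} {S : Set (Below κ)} {A : Below κ → Set (Below κ)}
  {Γ' : Set GammaOmega} {H : Type v} [AddCommGroup H]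

theorem multiples_pow_antitone {k l : ℕ} (h : k ≤ l) :
    multiples (p ^ l) H ≤ multiples (p ^ k) H := by
  rintro _ ⟨y, rfl⟩
  refine ⟨p ^ (l - k) • y, ?_⟩
  simp only [nsmulAddMonoidHom_apply]
  rw [← mul_nsmul', ← pow_add, Nat.add_sub_cancel' h]

/-- The level `α` of the representation `R` is compatible with the embedding `f` and with
closures of lower levels. -/
structure IsGoodLevel (f : BranchGroup p S A Γ' →+ H) (R : Below κ → AddSubgroup H)
    (α : Below κ) : Prop where
  isSuccLimit : Order.IsSuccLimit α
  preimage : ∀ z, f z ∈ R α → z ∈ groupBelow p S A Γ' α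
  elemX : ∀ s ∈ nodesBelow α, f (elemX p S A Γ' s) ∈ R α
  closure : ∀ β < α, pClosure p (R β : Set H) ⊆ R α

/-- Closing off: for each `β` the elements of `R β`, the nodes below `β` and, by stability, the
closure of `R β` number fewer than `κ`, so one `F β` bounds all that they require. -/
theorem exists_club_isGoodLevel (hκ : κ.IsRegular) (hκ' : ℵ₀ < κ) (hA : ∀ δ ∈ S, A δ ⊆ Set.Iio δ)
    (hH : IsStable p κ H) {f : BranchGroup p S A Γ' →+ H} (hf : Function.Injective f)
    {R : Below κ → AddSubgroup H} (hR : IsRepresentation R) :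
    ∃ E : Set (Below κ), IsClub E ∧ ∀ α ∈ E, IsGoodLevel f R α := by
  have : NoMaxOrder (Below κ) := Cardinal.noMaxOrder hκ.aleph0_le
  have hmono := hR.monotone hκ
  have hlevel : ∀ h : H, ∃ γ, h ∈ R γ := fun h => by
    have : h ∈ ⋃ α, (R α : Set H) := hR.union ▸ Set.mem_univ h
    exact Set.mem_iUnion.1 this
  choose L hL using hlevel
  choose M hM using exists_mem_groupBelow (Γ' := Γ') p hκ hκ' hA
  have key : ∀ β, ∃ γ, β < γ ∧ (∀ z, f z ∈ R β → z ∈ groupBelow p S A Γ' γ) ∧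
      (∀ s ∈ nodesBelow β, f (StableGroups.elemX p S A Γ' s) ∈ R γ) ∧
      pClosure p (R β : Set H) ⊆ R γ := by
    intro β
    obtain ⟨γ₁, h₁⟩ : ∃ γ, ∀ z, f z ∈ R β → z ∈ groupBelow p S A Γ' γ := by
      have : Nonempty (BranchGroup p S A Γ') := ⟨0⟩
      obtain ⟨γ, hγ⟩ := exists_forall_lt_of_range hκ
        (fun r : R β => M (Function.invFun f r.1)) (hR.card_lt β)
      refine ⟨γ, fun z hz => ?_⟩
      have h := hγ ⟨f z, hz⟩
      simp only [Function.leftInverse_invFun hf z] at h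
      exact groupBelow_mono p h.le (hM z)
    obtain ⟨γ₂, h₂⟩ := exists_forall_lt_of_range hκ
      (fun s : nodesBelow β => L (f (StableGroups.elemX p S A Γ' s.1)))
      (by simpa using mk_nodesBelow_lt hκ' β)
    have hcl := hH (R β) (hR.card_lt β)
    rw [AddSubgroup.closure_eq] at hcl
    obtain ⟨γ₃, h₃⟩ := exists_forall_lt_of_range hκ
      (fun h : pClosure p (R β : Set H) => L h.1) hcl
    refine ⟨max (Order.succ β) (max γ₁ (max γ₂ γ₃)), lt_max_of_lt_left (Order.lt_succ β),
      fun z hz => ?_, fun s hs => ?_, fun h hh => ?_⟩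
    · exact groupBelow_mono p (by simp) (h₁ z hz)
    · exact hmono ((h₂ ⟨s, hs⟩).le.trans (by simp)) (hL _)
    · exact hmono ((h₃ ⟨h, hh⟩).le.trans (by simp)) (hL _)
  choose F hF hF₁ hF₂ hF₃ using key
  refine ⟨_, isClub_closedUnder hκ hκ' F, ?_⟩
  rintro α ⟨⟨β₀, hβ₀⟩, hα⟩
  have hlim : Order.IsSuccLimit α := by
    refine ⟨fun h => h.not_lt hβ₀, ?_⟩
    by_contra hα'
    obtain ⟨γ, hγ⟩ := not_forall_not.1 hα'
    obtain rfl := hγ.succ_eq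
    have h := hα γ (Order.lt_succ γ)
    exact absurd (hF γ) (not_lt.2 (Order.lt_succ_iff.1 h))
  refine ⟨hlim, fun z hz => ?_, fun s hs => ?_, fun β hβ => ?_⟩
  · have hz' : f z ∈ (R α : Set H) := hz
    rw [hR.limit α hlim] at hz'
    obtain ⟨β, hβ, hz'⟩ := Set.mem_iUnion₂.1 hz'
    exact groupBelow_mono p (hα β hβ).le (hF₁ β z hz')
  · have : Nonempty (Set.Iio α) := ⟨⟨β₀, hβ₀⟩⟩
    -- The finitely many entries of `s` have a bound `β < α`; two applications of `F` stay below
    -- `α`.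
    obtain ⟨β, hβ⟩ := Finite.exists_le (fun i => (⟨s.2.1 i, hs i⟩ : Set.Iio α))
    have hs' : s ∈ nodesBelow (F β.1) := fun i => lt_of_le_of_lt (hβ i) (hF β.1)
    exact hmono (hα _ (hα _ β.2)).le (hF₂ _ s hs')
  · exact (hF₃ β).trans (hmono (hα β hβ).le)

/-- A good level of uncountable cofinality is closed. -/
theorem IsGoodLevel.exists_notMem_sup (hκ : κ.IsRegular)
    {f : BranchGroup p S A Γ' →+ H} {R : Below κ → AddSubgroup H} (hR : IsRepresentation R)
    {α : Below κ} (hα : IsGoodLevel f R α) (hcof : ℵ₀ < Order.cof (Set.Iio α)) {z : H}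
    (hz : z ∉ R α) : ∃ k, z ∉ R α ⊔ multiples (p ^ k) H := by
  by_contra! hcon
  have h : ∀ k : ℕ, ∃ β : Set.Iio α, ∃ a ∈ R β.1, ∃ y, p ^ k • y = z - a := by
    intro k
    obtain ⟨a, ha, m, ⟨y, rfl⟩, rfl⟩ := AddSubgroup.mem_sup.1 (hcon k)
    have ha' : a ∈ (R α : Set H) := ha
    rw [hR.limit α hα.isSuccLimit] at ha'
    obtain ⟨β, hβ, ha'⟩ := Set.mem_iUnion₂.1 ha'
    exact ⟨⟨β, hβ⟩, a, ha', y, by simp⟩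
  choose β a ha hy using h
  -- Countably many levels are not cofinal in `α`, so all the approximations lie in one `R γ` with
  -- `γ < α`, whose closure is inside `R α`.
  have hnc : ¬ IsCofinal (Set.range β) := by
    intro hc
    refine absurd (Order.cof_le hc) (not_le.2 (lt_of_le_of_lt ?_ hcof))
    simpa using Cardinal.mk_range_le_lift (f := β)
  obtain ⟨γ, hγ⟩ := not_isCofinal_iff.1 hnc
  refine hz (hα.closure γ.1 γ.2 (mem_pClosure_iff.2 fun k => ⟨a k, ?_, hy k⟩))
  exact hR.monotone hκ (le_of_lt (hγ _ ⟨k, rfl⟩)) (ha k)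

/-- Allows a level to be tested on a marker `x` instead of `g`, with `n = p^k`. -/
theorem mem_Inv_of_sub_mem (hp : p.Prime) {R : Below κ → AddSubgroup H} {c : Set (Below κ)}
    {α β : Below κ} (hα : α ∈ c) (hβ : IsLeast {γ | γ ∈ c ∧ α < γ} β) (hαβ : R α ≤ R β)
    {g x : H} {k : ℕ} (hk : k ≠ 0) (hx : x ∈ R β) (hx' : x ∉ R α ⊔ multiples (p ^ k) H)
    (hg : g - x ∈ R α ⊔ multiples (p ^ k) H) : α ∈ Inv R g c := by
  refine ⟨hα, β, hβ, p ^ k, ?_, ?_, fun h => hx' ?_⟩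
  · exact hp.two_le.trans (Nat.le_self_pow hk p)
  · have := add_mem (sup_le_sup_right hαβ (multiples (p ^ k) H) hg) (AddSubgroup.mem_sup_left hx)
    rwa [sub_add_cancel] at this
  · have := sub_mem h hg
    rwa [sub_sub_cancel] at this

/-- If all elements of `c` are good levels, then some invariant on `c` contains a given increasing
sequence of elements of `c` of uncountable cofinality. -/
theorem exists_forall_mem_Inv (hp : p.Prime) (hκ : κ.IsRegular) (hΓ : EventuallyDominates Γ')
    {f : BranchGroup p S A Γ' →+ H} {R : Below κ → AddSubgroup H} (hR : IsRepresentation R)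
    {c : Set (Below κ)} (hc : ∀ α ∈ c, IsGoodLevel f R α) (η : enumerations S A)
    (hηc : ∀ n, η.1 n ∈ c) (hcof : ∀ n, ℵ₀ < Order.cof (Set.Iio (η.1 n))) :
    ∃ g : H, ∀ n, η.1 n ∈ Inv R g c := by
  have hη : StrictMono η.1 := η.2.1
  have hmono := hR.monotone hκ
  -- the next elements
  have hnext : ∀ n, ∃ β, IsLeast {γ | γ ∈ c ∧ η.1 n < γ} β := by
    intro n
    obtain ⟨β, hβ, hmin⟩ := wellFounded_lt.has_min {γ | γ ∈ c ∧ η.1 n < γ}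
      ⟨η.1 (n + 1), hηc _, hη (Nat.lt_succ_self n)⟩
    exact ⟨β, hβ, fun γ hγ => not_lt.1 (hmin γ hγ)⟩
  choose nx hnx using hnext
  have hlt : ∀ n, η.1 n < nx n := fun n => (hnx n).1.2
  have hle : ∀ {m n}, m < n → nx m ≤ η.1 n := fun {m n} h => (hnx m).2 ⟨hηc n, hη h⟩
  have hXmem : ∀ n m (ρ : GammaFin m), m ≤ n →
      f (elemX p S A Γ' ⟨m, restr η.1 m, ρ⟩) ∈ R (η.1 n) := fun n m ρ hmn =>
    (hc _ (hηc n)).elemX _ fun i => hη (i.2.trans_le hmn)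
  -- The marker of level `n`: its node has length `n + 1`, so its last entry is `η n` itself. It
  -- lies in the next level `R (nx n)` but not in `R (η n)`.
  let x : ∀ n, GammaFin (n + 1) → H := fun n ρ =>
    p ^ total ρ.1 • f (elemX p S A Γ' ⟨n + 1, restr η.1 (n + 1), ρ⟩)
  have hx : ∀ n ρ, x n ρ ∈ R (nx n) := fun n ρ =>
    AddSubgroup.nsmul_mem _ ((hc _ (hnx n).1.1).elemX _ fun i =>
      (hη.monotone (Nat.lt_succ_iff.1 i.2)).trans_lt (hlt n)) _
  have hx' : ∀ n ρ, ∃ k, x n ρ ∉ R (η.1 n) ⊔ multiples (p ^ k) H := by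
    intro n ρ
    refine (hc _ (hηc n)).exists_notMem_sup hκ hR (hcof n) fun h => ?_
    have hs : (⟨n + 1, restr η.1 (n + 1), ρ⟩ : Node κ) ∉ nodesBelow (η.1 n) := fun h =>
      lt_irrefl _ (h (Fin.last n))
    refine pow_weight_nsmul_elemX_notMem p hp hs ((hc _ (hηc n)).preimage _ ?_)
    rw [map_nsmul]
    exact h
  choose K hK using hx'
  -- elements of large height witnessing the first levels
  have hz : ∀ n k, ∃ z l, k < l ∧ z ∈ multiples (p ^ k) H ∧ z ∈ R (nx n) ∧
      z ∉ R (η.1 n) ⊔ multiples (p ^ l) H := by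
    intro n k
    -- Starting above `k` makes the marker divisible by `p^k`.
    let ρ : GammaFin (n + 1) := ⟨fun i => k + 1 + i, fun i j h => by
      have : (i : ℕ) < j := h
      simp only
      omega, fun i => by simp only; omega⟩
    have hkρ : k ≤ total ρ.1 := by
      have := Finset.single_le_sum (f := ρ.1) (fun _ _ => Nat.zero_le _)
        (Finset.mem_univ (0 : Fin (n + 1)))
      refine le_trans ?_ this
      simp only [ρ]
      omega
    refine ⟨x n ρ, max (K n ρ) (k + 1), by omega, multiples_pow_antitone hkρ ⟨_, rfl⟩, hx n ρ,
      fun h => hK n ρ ?_⟩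
    exact sup_le_sup_left (multiples_pow_antitone (le_max_left _ _)) _ h
  choose Z l hkl hZ hZ' hZ'' using hz
  -- Each height exceeds the precision needed at the previous level, so later corrections do not
  -- disturb earlier levels.
  let k : ℕ → ℕ := fun n => Nat.rec 0 (fun n k => l n k) n
  have hk : ∀ n, k (n + 1) = l n (k n) := fun n => rfl
  have hkmono : StrictMono k := strictMono_nat_of_lt_succ fun n => hk n ▸ hkl n (k n)
  -- the branch
  classical
  -- The term at position `n + 1` must exceed the precision for the marker of level `n`, hence the
  -- shift. The value `0` off `GammaFin` is irrelevant, and the `k` part keeps the tail invisible at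
  -- the corrected levels.
  let h : (n : ℕ) → (Fin n → ℕ) → ℕ := fun n => match n with
    | 0 => fun _ => k 1
    | n + 1 => fun s => max (if hs : s ∈ GammaFin (n + 1) then K n ⟨s, hs⟩ else 0) (k (n + 2))
  have hhk : ∀ n s, k (n + 1) ≤ h n s := by
    rintro (_ | n) s
    · exact le_rfl
    · exact le_max_right _ _
  have hhK : ∀ n (s : GammaFin (n + 1)), K n s ≤ h (n + 1) s.1 := fun n s => by
    refine le_trans ?_ (le_max_left _ _)
    rw [dif_pos s.2]
  obtain ⟨ρ, hρ, hdom⟩ := hΓ h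
  obtain ⟨N, hN⟩ := Filter.eventually_atTop.1 hdom
  let b : Branch S A Γ' := (η, ⟨ρ, hρ⟩)
  let t : ℕ → ℕ := fun n => total (restr ρ.1 n)
  have ht : ∀ n, t (n + 1) = t n + ρ.1 n := total_restr_succ ρ.1
  let w : ℕ → H := fun n => p ^ t n • f (elemY p S A Γ' b n)
  have hw : ∀ n, w n = p ^ t n • f (elemX p S A Γ' (b.node n)) + w (n + 1) := by
    intro n
    simp only [w]
    rw [elemY_eq, map_add, smul_add, map_nsmul, ht, ← mul_nsmul', ← pow_add]
  -- Domination holds only from `N` on: the sum serves levels `0` to `N`, the tail of the branch all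
  -- later ones.
  refine ⟨∑ m ∈ Finset.range (N + 1), Z m (k m) + w (N + 1), fun n => ?_⟩
  have hRn : R (η.1 n) ≤ R (nx n) := hmono (hlt n).le
  rcases lt_or_ge n (N + 1) with hn | hn
  · refine mem_Inv_of_sub_mem hp (hηc n) (hnx n) hRn (k := k (n + 1)) ?_ (hZ' n (k n))
      (hZ'' n (k n)) ?_
    · exact (Nat.zero_le _).trans_lt (hkmono (Nat.lt_succ_self n)) |>.ne'
    · rw [← Finset.add_sum_erase _ _ (Finset.mem_range.2 hn), add_assoc, add_sub_cancel_left]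
      -- Corrections before `n` lie in `R (η n)`; those after `n`, like the tail, are divisible by
      -- `p^(k (n+1))`.
      refine add_mem (AddSubgroup.sum_mem _ fun m hm => ?_) (AddSubgroup.mem_sup_right ?_)
      · rcases lt_or_gt_of_ne (Finset.ne_of_mem_erase hm) with hmn | hmn
        · exact AddSubgroup.mem_sup_left (hmono (hle hmn) (hZ' m (k m)))
        · exact AddSubgroup.mem_sup_right
            (multiples_pow_antitone (hkmono.monotone hmn) (hZ m (k m)))
      · have h1 : k (N + 1) ≤ t (N + 1) := by
          rw [ht]
          exact ((hhk N _).trans (hN N le_rfl).le).trans (Nat.le_add_left _ _)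
        exact multiples_pow_antitone ((hkmono.monotone hn).trans h1) ⟨_, rfl⟩
  · have hKt : K n ⟨restr ρ.1 (n + 1), ρ.2 _⟩ < t (n + 2) := by
      rw [ht]
      exact ((hhK n ⟨restr ρ.1 (n + 1), ρ.2 _⟩).trans_lt (hN (n + 1) (by omega))).trans_le
        (Nat.le_add_left _ _)
    refine mem_Inv_of_sub_mem hp (hηc n) (hnx n) hRn (k := t (n + 2)) (by omega)
      (hx n ⟨restr ρ.1 (n + 1), ρ.2 _⟩) (fun h => hK n _
        (sup_le_sup_left (multiples_pow_antitone hKt.le) _ h)) ?_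
    have hsum : ∑ m ∈ Finset.range (N + 1), Z m (k m) ∈ R (η.1 n) :=
      AddSubgroup.sum_mem _ fun m hm =>
        hmono (hle ((Finset.mem_range.1 hm).trans_le hn)) (hZ' m (k m))
    -- Expanding the branch up to length `n + 1` uses only nodes below `η n`. The next term is the
    -- marker, and the remainder `w (n + 2)` is divisible by `p^(t (n+2))`.
    have htail : ∀ j, N + 1 ≤ j → j ≤ n + 1 → w (N + 1) - w j ∈ R (η.1 n) := by
      intro j hj
      induction j, hj using Nat.le_induction with
      | base => intro _; rw [sub_self]; exact zero_mem _
      | succ j hj ih =>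
        intro hjn
        have h1 := ih (by omega)
        have h2 : p ^ t j • f (elemX p S A Γ' (b.node j)) ∈ R (η.1 n) :=
          AddSubgroup.nsmul_mem _ (hXmem n j ⟨restr ρ.1 j, ρ.2 j⟩ (by omega)) _
        have h3 := add_mem h1 h2
        have : w (N + 1) - w j + p ^ t j • f (elemX p S A Γ' (b.node j)) =
            w (N + 1) - w (j + 1) := by
          rw [hw j]; abel
        rwa [this] at h3
    have h4 := htail (n + 1) (by omega) le_rfl
    have h5 : ∑ m ∈ Finset.range (N + 1), Z m (k m) + w (N + 1) -
        x n ⟨restr ρ.1 (n + 1), ρ.2 _⟩ =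
        (∑ m ∈ Finset.range (N + 1), Z m (k m) + (w (N + 1) - w (n + 1))) + w (n + 2) := by
      have : w (n + 1) = x n ⟨restr ρ.1 (n + 1), ρ.2 _⟩ + w (n + 2) := hw (n + 1)
      rw [this]; abel
    rw [h5]
    exact AddSubgroup.add_mem_sup (add_mem hsum h4) ⟨_, rfl⟩

/-- A set of order type `ω` is the range of a strictly increasing sequence. -/
theorem exists_strictMono_range_eq {a : Set (Below κ)} (ha : typeLT a = ω) :
    ∃ η : ℕ → Below κ, StrictMono η ∧ Set.range η = a := by
  have h : Ordinal.lift.{u} (typeLT ℕ) = Ordinal.lift.{0} (typeLT a) := by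
    rw [ha, Ordinal.type_nat_lt, Ordinal.lift_omega0, Ordinal.lift_omega0]
  obtain ⟨e⟩ := Ordinal.lift_type_eq.1 h
  refine ⟨fun n => e n, fun m n hmn => e.map_rel_iff.2 hmn, ?_⟩
  ext x
  constructor
  · rintro ⟨n, rfl⟩
    exact (e n).2
  · intro hx
    exact ⟨e.symm ⟨x, hx⟩, by simp⟩

theorem setOf_not_invFamily_mem_guessingIdeal (hp : p.Prime) (hΓ : EventuallyDominates Γ')
    (hκ : κ.IsRegular) (hκ' : ℵ₀ < κ) {C : Below κ → Set (Below κ)}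
    (hC : ∀ δ ∈ S, C δ ⊆ Set.Iio δ) (hAC : ∀ δ ∈ S, A δ ⊆ C δ) (hAω : ∀ δ ∈ S, typeLT (A δ) = ω)
    (hcof : ∀ δ ∈ S, ∀ α ∈ A δ, ℵ₀ < Order.cof (Set.Iio α)) (hH : IsStable p κ H)
    (hf : ∃ f : BranchGroup p S A Γ' →+ H, Function.Injective f)
    {R : Below κ → AddSubgroup H} (hR : IsRepresentation R) :
    {δ ∈ S | ¬ ∃ B ∈ invFamily R (C δ), A δ ⊆ B} ∈ guessingIdeal S C := by
  obtain ⟨f, hf⟩ := hf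
  obtain ⟨E, hE, hgood⟩ := exists_club_isGoodLevel hκ hκ'
    (fun δ hδ => (hAC δ hδ).trans (hC δ hδ)) hH hf hR
  refine ⟨E, hE, ?_⟩
  rintro δ ⟨⟨⟨hδ, hno⟩, -⟩, -⟩ hCE
  obtain ⟨η, hη, hr⟩ := exists_strictMono_range_eq (hAω δ hδ)
  have hmem : ∀ n, η n ∈ A δ := fun n => hr ▸ Set.mem_range_self n
  obtain ⟨g, hg⟩ := exists_forall_mem_Inv hp hκ hΓ hR (fun α hα => hgood α (hCE hα))
    ⟨η, hη, δ, hδ, hr⟩ (fun n => hAC δ hδ (hmem n)) (fun n => hcof δ hδ _ (hmem n))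
  refine hno ⟨_, ⟨g, rfl⟩, ?_⟩
  rw [← hr]
  rintro _ ⟨n, rfl⟩
  exact hg n

end Invariants

/-! ### Dominating sets of branches -/

section Dominating

theorem dominatingNumber_le {D : Set (ℕ → ℕ)}
    (hD : ∀ f : ℕ → ℕ, ∃ g ∈ D, ∀ᶠ n in Filter.atTop, f n ≤ g n) : dominatingNumber ≤ #D :=
  csInf_le' ⟨D, hD, rfl⟩

theorem exists_mk_eq_dominatingNumber : ∃ D : Set (ℕ → ℕ),
    (∀ f : ℕ → ℕ, ∃ g ∈ D, ∀ᶠ n in Filter.atTop, f n ≤ g n) ∧ #D = dominatingNumber :=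
  csInf_mem (s := {c | ∃ D : Set (ℕ → ℕ),
    (∀ f : ℕ → ℕ, ∃ g ∈ D, ∀ᶠ n in Filter.atTop, f n ≤ g n) ∧ #D = c})
    ⟨_, Set.univ, fun f => ⟨f, Set.mem_univ f, Filter.Eventually.of_forall fun _ => le_rfl⟩, rfl⟩

/-- Bounds depending only on the length of the sequence already make the branches a dominating
family. -/
theorem dominatingNumber_le_mk {Γ' : Set GammaOmega} (h : EventuallyDominates Γ') :
    dominatingNumber ≤ #Γ' := by
  refine (dominatingNumber_le (D := Set.range fun ρ : Γ' => ρ.1.1) fun f => ?_).trans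
    Cardinal.mk_range_le
  obtain ⟨ρ, hρ, hlt⟩ := h fun n _ => f n
  exact ⟨ρ.1, ⟨⟨ρ, hρ⟩, rfl⟩, hlt.mono fun n hn => hn.le⟩

/-- A code for a finite sequence of natural numbers. -/
def code (s : Σ n, Fin n → ℕ) : ℕ := Encodable.encode (List.ofFn s.2)

theorem code_injective : Function.Injective code := fun s t h => by
  have := Encodable.encode_injective h
  exact List.ofFn_inj'.1 this

/-- The first terms of the branch that grows faster than `g` along its own initial segments. -/
def growList (g : ℕ → ℕ) : ℕ → List ℕ
  | 0 => []
  | n + 1 => growList g n ++ [g (Encodable.encode (growList g n)) + (growList g n).sum + 1]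

/-- The branch that grows faster than `g` along its own initial segments. -/
def grow (g : ℕ → ℕ) (n : ℕ) : ℕ :=
  g (Encodable.encode (growList g n)) + (growList g n).sum + 1

theorem ofFn_restr_grow (g : ℕ → ℕ) (n : ℕ) : List.ofFn (restr (grow g) n) = growList g n := by
  induction n with
  | zero => rfl
  | succ n ih =>
    rw [List.ofFn_succ', List.concat_eq_append, growList]
    exact congrArg₂ (· ++ [·]) ih rfl

/-- Adding the sum of all earlier terms plus one forces strict growth whatever `g` is. -/
theorem strictMono_grow (g : ℕ → ℕ) : StrictMono (grow g) := by
  refine strictMono_nat_of_lt_succ fun n => ?_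
  have h : (growList g (n + 1)).sum = (growList g n).sum + grow g n := by
    rw [growList, List.sum_append, List.sum_singleton, grow]
  rw [grow.eq_1 g (n + 1), h]
  omega

theorem grow_mem_GammaOmega (g : ℕ → ℕ) : grow g ∈ GammaOmega := fun _ =>
  ⟨fun _ _ h => strictMono_grow g h, fun _ => Nat.succ_ne_zero _⟩

theorem exists_eventuallyDominates_mk_eq : ∃ Γ' : Set GammaOmega,
    EventuallyDominates Γ' ∧ #Γ' = dominatingNumber := by
  obtain ⟨D, hD, hcard⟩ := exists_mk_eq_dominatingNumber
  have hdom : EventuallyDominates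
      (Set.range fun g : D => (⟨grow g.1, grow_mem_GammaOmega g.1⟩ : GammaOmega)) := by
    intro h
    obtain ⟨g, hg, hle⟩ := hD fun c => Function.extend code (fun s => h s.1 s.2) 0 c
    refine ⟨_, ⟨⟨g, hg⟩, rfl⟩, ?_⟩
    -- Initial segments of different lengths have different codes, so the codes tend to infinity and
    -- a bound valid at almost all codes holds along the branch.
    have hinj : Function.Injective fun n => code ⟨n, restr (grow g) n⟩ := fun m n hmn =>
      congrArg Sigma.fst (code_injective hmn)
    have hev := hinj.nat_tendsto_atTop.eventually hle
    filter_upwards [hev] with n hn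
    rw [code_injective.extend_apply] at hn
    refine hn.trans_lt ?_
    change g (Encodable.encode (List.ofFn (restr (grow g) n))) < grow g n
    rw [ofFn_restr_grow, grow]
    omega
  refine ⟨_, hdom, le_antisymm ?_ (dominatingNumber_le_mk hdom)⟩
  rw [← hcard]
  exact Cardinal.mk_range_le

end Dominating

end StableGroups
theorem mainTheorem6 :
    (∀ (p : ℕ), p.Prime →
      ∀ (Γ' : Set StableGroups.GammaOmega), StableGroups.EventuallyDominates Γ' →
      ∀ (κ : Cardinal.{u}), κ.IsRegular → Cardinal.lift.{u} #Γ' < κ →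
      ∀ (S : Set (StableGroups.Below κ))
        (C A : StableGroups.Below κ → Set (StableGroups.Below κ)),
        StableGroups.IsClubGuessing S C →
        (∀ δ ∈ S, A δ ⊆ C δ) →
        (∀ δ ∈ S, typeLT (A δ) = ω) →
        (∀ δ ∈ S, ∀ α ∈ A δ, ℵ₀ < Order.cof (Set.Iio α)) →
        (∀ α : StableGroups.Below κ,
          #{a : Set (StableGroups.Below κ) // (∃ δ ∈ S, A δ = a) ∧ a ⊆ Set.Iio α} < κ) →
        StableGroups.IsPrimaryGroup p (StableGroups.BranchGroup p S A Γ') ∧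
        StableGroups.IsReducedGroup (StableGroups.BranchGroup p S A Γ') ∧
        StableGroups.IsSeparableGroup (StableGroups.BranchGroup p S A Γ') ∧
        StableGroups.IsStable p κ (StableGroups.BranchGroup p S A Γ') ∧
        #(StableGroups.BranchGroup p S A Γ') = κ ∧
        ∀ (H : Type v) [AddCommGroup H],
          StableGroups.IsPrimaryGroup p H → StableGroups.IsSeparableGroup H →
          StableGroups.IsStable p κ H → Cardinal.lift.{u} #H = Cardinal.lift.{v} κ →
          (∃ f : StableGroups.BranchGroup p S A Γ' →+ H, Function.Injective f) →
          ∀ (R : StableGroups.Below κ → AddSubgroup H), StableGroups.IsRepresentation R →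
            {δ ∈ S | ¬ ∃ B ∈ StableGroups.invFamily R (C δ), A δ ⊆ B} ∈
              StableGroups.guessingIdeal S C) ∧
    ∃ Γ' : Set StableGroups.GammaOmega,
      StableGroups.EventuallyDominates Γ' ∧ #Γ' = StableGroups.dominatingNumber := by
  refine ⟨?_, StableGroups.exists_eventuallyDominates_mk_eq⟩
  intro p hp Γ' hΓ κ hκ hΓκ S C A hC hAC hAω hcof hfew
  -- Uncountability of `κ` comes from that of `Γ'`.
  have hκ' : ℵ₀ < κ := by
    refine lt_of_lt_of_le ?_ hΓκ.le
    simpa using StableGroups.aleph0_lt_of_eventuallyDominates hΓ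
  have hA : ∀ δ ∈ S, A δ ⊆ Set.Iio δ := fun δ hδ => (hAC δ hδ).trans (hC.1 δ hδ)
  have hprim := StableGroups.isPrimaryGroup_branchGroup p S A Γ'
  have hheight := StableGroups.eq_zero_of_infinite_height p S A Γ' hp
  exact ⟨hprim, StableGroups.isReducedGroup_of_height hp hheight,
    StableGroups.isSeparableGroup_of_height hp hprim hheight,
    StableGroups.isStable_branchGroup p hp hκ hκ' hΓκ hA hfew,
    StableGroups.mk_branchGroup p hp hκ hκ' hΓκ hA hfew,
    fun H _ _ _ hH _ hf R hR => StableGroups.setOf_not_invFamily_mem_guessingIdeal hp hΓ hκ hκ'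
      hC.1 hAC hAω hcof hH hf hR⟩
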